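/- Let $\mathcal{O}_K$ be a principal ideal domain with field of fractions $K$, fix an algebraic closure $\overline{K}$ of $K$, and for a finite extension $E/K$ let $\mathcal{O}_E$ be the integral closure of $\mathcal{O}_K$ in $E$. Let $L_1/K$ and $L_2/K$ be finite separable extensions inside $\overline{K}$ that are almost classically Galois with Galois complements $M_1,M_2\subseteq\overline{K}$; that is, $M_i/K$ is Galois and the multiplication map is an isomorphism of $L_i\otimes_K M_i$ onto the normal closure $\widetilde{L_i}$ of $L_i/K$. Assume that $L_1/K$ and $L_2/K$ are - strongly disjoint: $L_1$ and $L_2$ are $K$-linearly disjoint and $L_1\cap M_2=L_2\cap M_1=K$; - arithmetically disjoint: $L_1$ and $L_2$ are $K$-linearly disjoint and the discriminant ideals of $\mathcal{O}_{L_1}/\mathcal{O}_K$ and $\mathcal{O}_{L_2}/\mathcal{O}_K$ are coprime. Let $L=L_1L_2$, with normal closure $\widetilde{L}$. Put $G=\mathrm{Gal}(\widetilde{L}/K)$, $G'=\mathrm{Gal}(\widetilde{L}/L)$, $G_i=\mathrm{Gal}(\widetilde{L_i}/K)$, $G_i'=\mathrm{Gal}(\widetilde{L_i}/L_i)$. A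 Hopf-Galois structure on a finite extension $E/K$ is a finite-dimensional cocommutative $K$-Hopf algebra $H$ with a $K$-linear action on $E$ making $E$ an $H$-module algebra such that $E\otimes_K H\to\mathrm{End}_K(E)$, $x\otimes h\mapsto(y\mapsto x(h\cdot y))$, is bijective. For $E/K$ separable with normal closure $\widetilde{E}$, $\Gamma=\mathrm{Gal}(\widetilde{E}/K)$, $\Gamma'=\mathrm{Gal}(\widetilde{E}/E)$ and left translation map $\lambda\colon\Gamma\to\mathrm{Perm}(\Gamma/\Gamma')$, the structure is said to be given by a regular subgroup $N\le\mathrm{Perm}(\Gamma/\Gamma')$ normalized by $\lambda(\Gamma)$ if $H$ is identified, as a $K$-Hopf algebra, with $\widetilde{E}[N]^{\Gamma}$ ($\Gamma$ acting on $\widetilde{E}$ by evaluation and on $N$ by conjugation by $\lambda(\Gamma)$), the action being $(\sum_\eta h_\eta\,\eta)\cdot\alpha=\sum_\eta h_\eta\,(\eta^{-1}(1_\Gamma\Gamma'))(\alpha)$, where $(g\Gamma')(\alpha)=g(\alpha)$. Let $H_i$ be a Hopf-Galois structure on $L_i/K$, given by the permutation subgroup $N_i$, for $i\in\{1,2\}$.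 Let $H$ be their product Hopf-Galois structure on $L/K$, namely the one given by $N=\iota(N_1\times N_2)$, where $\iota\colon\mathrm{Perm}(G_1/G_1')\times\mathrm{Perm}(G_2/G_2')\to\mathrm{Perm}(G/G')$ is induced by the bijection $G/G'\to G_1/G_1'\times G_2/G_2'$, $gG'\mapsto(g|_{\widetilde{L_1}}G_1',g|_{\widetilde{L_2}}G_2')$. Finally, for a Hopf-Galois structure $H$ on $E/K$ let $\mathfrak{A}_H=\{h\in H : h\cdot\alpha\in\mathcal{O}_E\text{ for all }\alpha\in\mathcal{O}_E\}$ be its associated order. Then: 1. $\mathfrak{A}_H=\mathfrak{A}_{H_1}\otimes_{\mathcal{O}_K}\mathfrak{A}_{H_2}$. Precisely, there is an isomorphism of $K$-algebras $f\colon H_1\otimes_K H_2\to H$ with $$f\Big(\sum_{\eta_1} a_{\eta_1}\eta_1\otimes\sum_{\eta_2} b_{\eta_2}\eta_2\Big)=\sum_{\eta_1,\eta_2}a_{\eta_1}b_{\eta_2}\,\iota(\eta_1,\eta_2),$$ and there is an isomorphism of $\mathcal{O}_K$-algebras $\mathfrak{A}_{H_1}\otimes_{\mathcal{O}_K}\mathfrak{A}_{H_2}\to\mathfrak{A}_H$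 sending $a_1\otimes a_2$ to $f(a_1\otimes a_2)$. 2. If $\mathcal{O}_{L_i}$ is a free $\mathfrak{A}_{H_i}$-module for $i\in\{1,2\}$, then $\mathcal{O}_L$ is a free $\mathfrak{A}_H$-module. -/

import Mathlib

open scoped TensorProduct

/-! ### Hopf-Galois structures and associated orders -/

/-- A Hopf-Galois structure on a finite field extension `L/K` with underlying Hopf algebra `H`:
`H` is a finite-dimensional cocommutative `K`-Hopf algebra acting `K`-linearly on `L`, in such a way
that `L` is an `H`-module algebra and `L ⊗ H → End_K(L)`, `x ⊗ h ↦ (y ↦ x (h · y))`, is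
bijective. -/
structure HopfGaloisStructure (K L H : Type*) [Field K] [Field L] [Algebra K L]
    [Ring H] [HopfAlgebra K H] where
  finite : Module.Finite K H
  cocomm : Coalgebra.IsCocomm K H
  /-- the action `h · x = act h x` -/
  act : H →ₐ[K] Module.End K L
  act_one : ∀ h : H, act h 1 = algebraMap K L (Coalgebra.counit h)
  /-- `h · (x y) = ∑ (h₁ · x) (h₂ · y)` -/
  act_mul : ∀ (h : H) (x y : L), act h (x * y) =
    LinearMap.mul' K L
      (TensorProduct.map (act.toLinearMap.flip x) (act.toLinearMap.flip y) (Coalgebra.comul h))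
  bijective : Function.Bijective
    (TensorProduct.lift ((LinearMap.mul K (Module.End K L)).compl₁₂
      (Algebra.lmul K L).toLinearMap act.toLinearMap) : L ⊗[K] H → Module.End K L)

namespace HopfGaloisStructure

variable {K L H : Type*} [Field K] [Field L] [Algebra K L] [Ring H] [HopfAlgebra K H]

/-- The associated order `𝔄_H = {h ∈ H | h · α ∈ 𝒪_L for all α ∈ 𝒪_L}`, where `𝒪_L` is the
integral closure of `O` in `L`. -/
def associatedOrder (S : HopfGaloisStructure K L H) (O : Type*) [CommRing O] [Algebra O K]
    [Algebra O L] [IsScalarTower O K L] [Algebra O H] [IsScalarTower O K H] : Subalgebra O H where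
  carrier := {h | ∀ α ∈ integralClosure O L, S.act h α ∈ integralClosure O L}
  mul_mem' {a b} ha hb α hα := by
    rw [map_mul]
    exact ha _ (hb _ hα)
  add_mem' {a b} ha hb α hα := by
    rw [map_add]
    exact add_mem (ha _ hα) (hb _ hα)
  algebraMap_mem' r α hα := by
    rw [IsScalarTower.algebraMap_apply O K H, AlgHom.commutes, Module.algebraMap_end_apply,
      algebraMap_smul]
    exact Subalgebra.smul_mem _ hα r

/-- `𝒪_L` is a left module over the associated order, through the action of `H` on `L`. -/
instance (S : HopfGaloisStructure K L H) (O : Type*) [CommRing O] [Algebra O K]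
    [Algebra O L] [IsScalarTower O K L] [Algebra O H] [IsScalarTower O K H] :
    Module (S.associatedOrder O) (integralClosure O L) where
  smul h α := ⟨S.act h.1 α.1, h.2 α.1 α.2⟩
  one_smul α := Subtype.ext (show S.act 1 α.1 = α.1 by rw [map_one]; rfl)
  mul_smul a b α := Subtype.ext
    (show S.act (a.1 * b.1) α.1 = S.act a.1 (S.act b.1 α.1) by rw [map_mul]; rfl)
  smul_zero a := Subtype.ext (show S.act a.1 0 = 0 from map_zero _)
  smul_add a x y := Subtype.ext
    (show S.act a.1 (x.1 + y.1) = S.act a.1 x.1 + S.act a.1 y.1 from map_add _ _ _)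
  add_smul a b x := Subtype.ext
    (show S.act (a.1 + b.1) x.1 = S.act a.1 x.1 + S.act b.1 x.1 by rw [map_add]; rfl)
  zero_smul x := Subtype.ext (show S.act 0 x.1 = 0 by rw [map_zero]; rfl)

end HopfGaloisStructure

/-! ### Disjointness conditions inside an algebraic closure -/

section Disjointness

variable {K Kbar : Type*} [Field K] [Field Kbar] [Algebra K Kbar]

/-- `M` is a Galois complement of `L/K`: `M/K` is Galois and the multiplication map identifies
`L ⊗_K M` with the normal closure of `L/K`. -/
structure IsGaloisComplement (L M : IntermediateField K Kbar) : Prop where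
  isGalois : IsGalois K M
  linearDisjoint : L.LinearDisjoint M
  sup_eq : L ⊔ M = IntermediateField.normalClosure K L Kbar

/-- Strong disjointness of two almost classically Galois extensions `L₁/K`, `L₂/K` with respect to
the Galois complements `M₁`, `M₂`. -/
structure StronglyDisjoint (L₁ M₁ L₂ M₂ : IntermediateField K Kbar) : Prop where
  linearDisjoint : L₁.LinearDisjoint L₂
  inf_eq_bot : L₁ ⊓ M₂ = ⊥
  inf_eq_bot_symm : L₂ ⊓ M₁ = ⊥

/-- The discriminant ideal of `𝒪_L / O`: the ideal of `O` generated by the discriminants of the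
families of `[L : K]` elements of `𝒪_L` (these vanish unless the family is a `K`-basis of `L`). -/
def discriminantIdeal (O K L : Type*) [CommRing O] [Field K] [Field L] [Algebra O K] [Algebra K L]
    [Algebra O L] : Ideal O :=
  Ideal.span {d : O | ∃ b : Fin (Module.finrank K L) → integralClosure O L,
    algebraMap O K d = Algebra.discr K (fun i => (b i : L))}

/-- Arithmetic disjointness: linear disjointness together with coprimality of discriminants. -/
structure ArithmeticallyDisjoint (O : Type*) [CommRing O] [Algebra O K] [Algebra O Kbar]
    [IsScalarTower O K Kbar] (L₁ L₂ : IntermediateField K Kbar) : Prop where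
  linearDisjoint : L₁.LinearDisjoint L₂
  isCoprime_discr : IsCoprime (discriminantIdeal O K L₁) (discriminantIdeal O K L₂)

end Disjointness

/-! ### Greither-Pareigis theory -/

namespace GreitherPareigis

variable {K Kbar : Type*} [Field K] [Field Kbar] [Algebra K Kbar]

/-- The normal closure `L̃` of `L/K`. -/
noncomputable abbrev nc (L : IntermediateField K Kbar) : IntermediateField K Kbar :=
  IntermediateField.normalClosure K L Kbar

/-- The subgroup `G' = Gal(L̃/L)` of `G = Gal(L̃/K)`. -/
noncomputable abbrev stab (L : IntermediateField K Kbar) : Subgroup Gal(nc L/K) :=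
  (IntermediateField.restrict L.le_normalClosure).fixingSubgroup

/-- The set `X = G/G'` of left cosets. -/
abbrev Cosets (L : IntermediateField K Kbar) : Type _ := Gal(nc L/K) ⧸ stab L

/-- The left translation map `λ : G → Perm(G/G')`. -/
noncomputable def leftTranslation (L : IntermediateField K Kbar) : Gal(nc L/K) →* Equiv.Perm (Cosets L) :=
  MulAction.toPermHom _ _

theorem mem_stab {L : IntermediateField K Kbar} {g : Gal(nc L/K)} :
    g ∈ stab L ↔ ∀ x : nc L, (x : Kbar) ∈ L → g x = x := by
  rw [IntermediateField.mem_fixingSubgroup_iff]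
  simp only [IntermediateField.mem_restrict]

/-- The evaluation `(g G')(α) = g(α)` of a coset at an element of `L`. -/
noncomputable def evalCoset {L : IntermediateField K Kbar} (c : Cosets L) (α : L) : nc L :=
  Quotient.liftOn' c (fun g => g ⟨α, L.le_normalClosure α.2⟩) (by
    intro g h hgh
    rw [QuotientGroup.leftRel_apply] at hgh
    have h1 := mem_stab.1 hgh ⟨α, L.le_normalClosure α.2⟩ α.2
    exact ((congrArg g h1).symm.trans (by
      rw [AlgEquiv.mul_apply, ← AlgEquiv.mul_apply, mul_inv_cancel, AlgEquiv.one_apply])))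

/-- A regular subgroup `N` of `Perm(G/G')` that is normalized by `λ(G)`. -/
structure RegularSubgroup (L : IntermediateField K Kbar) where
  carrier : Subgroup (Equiv.Perm (Cosets L))
  /-- `N` acts simply transitively on `G/G'` -/
  regular : ∀ x y : Cosets L, ∃! η : carrier, (η : Equiv.Perm (Cosets L)) x = y
  normalized : ∀ g : Gal(nc L/K), ∀ η ∈ carrier,
    leftTranslation L g * η * (leftTranslation L g)⁻¹ ∈ carrier

namespace RegularSubgroup

variable {L : IntermediateField K Kbar} (N : RegularSubgroup L)

/-- The group algebra `L̃[N]`. -/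
abbrev GroupAlgebra : Type _ := MonoidAlgebra (nc L) N.carrier

/-- Conjugation by `λ(g)` on `N`. -/
noncomputable def conj (g : Gal(nc L/K)) : N.carrier →* N.carrier where
  toFun η := ⟨leftTranslation L g * η * (leftTranslation L g)⁻¹, N.normalized g η η.2⟩
  map_one' := Subtype.ext (by simp)
  map_mul' a b := Subtype.ext (by simp [mul_assoc])

/-- The action of `g ∈ G` on `L̃[N]`: evaluation on `L̃`, conjugation by `λ(g)` on `N`. -/
noncomputable def galAct (g : Gal(nc L/K)) : N.GroupAlgebra →ₐ[K] N.GroupAlgebra :=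
  (MonoidAlgebra.mapAlgHom N.carrier (g : nc L →ₐ[K] nc L)).comp
    (MonoidAlgebra.mapDomainAlgHom K (nc L) (N.conj g))

/-- The fixed `K`-algebra `L̃[N]^G`. -/
noncomputable def fixedAlgebra : Subalgebra K N.GroupAlgebra where
  carrier := {x | ∀ g, N.galAct g x = x}
  mul_mem' {a b} ha hb g := by rw [map_mul, ha g, hb g]
  add_mem' {a b} ha hb g := by rw [map_add, ha g, hb g]
  algebraMap_mem' r g := AlgHom.commutes _ r

end RegularSubgroup

/-- The Hopf-Galois structure `S` on `L/K`, with Hopf algebra `H`, is given by the permutation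
subgroup `N`: an identification `φ` of `H` with `L̃[N]^G`, as `K`-Hopf algebras (the coalgebra
structure is the restriction of the one of the group algebra `L̃[N]`), for which `H` acts by
`(∑ hᵢ ηᵢ) · α = ∑ hᵢ ηᵢ⁻¹(1 G')(α)`. -/
structure GivenBy {L : IntermediateField K Kbar} {H : Type*} [Ring H] [HopfAlgebra K H]
    (S : HopfGaloisStructure K L H) (N : RegularSubgroup L) where
  φ : H →ₐ[K] N.GroupAlgebra
  injective : Function.Injective φ
  range_eq : φ.range = N.fixedAlgebra
  counit_eq : ∀ h : H, Coalgebra.counit (R := nc L) (φ h) =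
    algebraMap K (nc L) (Coalgebra.counit (R := K) h)
  /-- `Δ(φ h)` is the image of `Δ(h)` under `H ⊗_K H → L̃[N] ⊗_K L̃[N] → L̃[N] ⊗_L̃ L̃[N]` -/
  comul_eq : ∀ h : H, Coalgebra.comul (R := nc L) (φ h) =
    TensorProduct.mapOfCompatibleSMul (nc L) K K N.GroupAlgebra N.GroupAlgebra
      (TensorProduct.map φ.toLinearMap φ.toLinearMap (Coalgebra.comul (R := K) h))
  act_eq : ∀ (h : H) (α : L), (S.act h α : Kbar) =
    (φ h).coeff.sum fun η c =>
      (c : Kbar) * evalCoset ((η : Equiv.Perm (Cosets L))⁻¹ ((1 : Gal(nc L/K)) : Cosets L)) α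

/-! ### The product of two permutation subgroups -/

section Product

set_option linter.unusedSectionVars false

variable [IsAlgClosure K Kbar]

instance normal_nc (L : IntermediateField K Kbar) : Normal K (nc L) :=
  haveI : Normal K Kbar := IsAlgClosure.normal K Kbar
  inferInstance

/-- The restriction map `Gal(F/K) → Gal(E/K)` for `E ≤ F` with `E/K` normal. -/
noncomputable def restrictHom {E F : IntermediateField K Kbar} [Normal K E] (h : E ≤ F) :
    Gal(F/K) →* Gal(E/K) :=
  letI := (IntermediateField.inclusion h).toRingHom.toAlgebra
  haveI : IsScalarTower K E F := IsScalarTower.of_algebraMap_eq fun _ => rfl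
  AlgEquiv.restrictNormalHom E

theorem coe_restrictHom {E F : IntermediateField K Kbar} [Normal K E] (h : E ≤ F)
    (g : Gal(F/K)) (x : E) : (restrictHom h g x : Kbar) = g ⟨x, h x.2⟩ := by
  let _ := (IntermediateField.inclusion h).toRingHom.toAlgebra
  have : IsScalarTower K E F := IsScalarTower.of_algebraMap_eq fun _ => rfl
  exact congrArg Subtype.val (AlgEquiv.restrictNormal_commutes g E x)

/-- For `E ≤ L`, the map `G_L/G_L' → G_E/G_E'` induced by restriction to `Ẽ`. -/
noncomputable def restrictCoset {E L : IntermediateField K Kbar} (h : E ≤ L) :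
    Cosets L → Cosets E :=
  Quotient.map' (restrictHom (IntermediateField.normalClosure_mono E L h)) (by
    intro a b hab
    rw [QuotientGroup.leftRel_apply] at hab ⊢
    rw [← map_inv, ← map_mul, mem_stab]
    intro x hx
    apply Subtype.ext
    rw [coe_restrictHom, mem_stab.1 hab _ (h hx)])

theorem restrictCoset_mk {E L : IntermediateField K Kbar} (h : E ≤ L) (g : Gal(nc L/K)) :
    restrictCoset h (g : Cosets L) =
      ((restrictHom (IntermediateField.normalClosure_mono E L h) g : Gal(nc E/K)) : Cosets E) :=
  rfl

variable (L₁ L₂ : IntermediateField K Kbar)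

/-- The map `ψ : G/G' → G₁/G₁' × G₂/G₂'`, `g G' ↦ (g|L̃₁ G₁', g|L̃₂ G₂')`, where `G`, `G'` belong
to the compositum `L₁ L₂`. -/
noncomputable def psi (x : Cosets (L₁ ⊔ L₂)) : Cosets L₁ × Cosets L₂ :=
  (restrictCoset le_sup_left x, restrictCoset le_sup_right x)

theorem psi_injective : Function.Injective (psi L₁ L₂) := by
  intro x y
  induction x using QuotientGroup.induction_on with | _ a
  induction y using QuotientGroup.induction_on with | _ b
  intro hab
  have h1 := congrArg Prod.fst hab
  have h2 := congrArg Prod.snd hab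
  simp only [psi, restrictCoset_mk] at h1 h2
  rw [QuotientGroup.eq, ← map_inv, ← map_mul, mem_stab] at h1 h2
  rw [QuotientGroup.eq]
  have key : L₁ ⊔ L₂ ≤ IntermediateField.lift (IntermediateField.fixedField
      (Subgroup.zpowers (a⁻¹ * b))) := by
    have aux : ∀ x : nc (L₁ ⊔ L₂), (a⁻¹ * b) x = x → (x : Kbar) ∈ IntermediateField.lift
        (IntermediateField.fixedField (Subgroup.zpowers (a⁻¹ * b))) := by
      intro x hx
      rw [IntermediateField.mem_lift, IntermediateField.mem_fixedField_iff]
      intro f hf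
      have : Subgroup.zpowers (a⁻¹ * b) ≤ MulAction.stabilizer _ x := by
        rw [Subgroup.zpowers_le]
        exact hx
      exact this hf
    refine sup_le (fun x hx => ?_) (fun x hx => ?_)
    · refine aux ⟨x, IntermediateField.le_normalClosure _ (le_sup_left (a := L₁) hx)⟩ ?_
      have := congrArg Subtype.val (h1 ⟨x, IntermediateField.le_normalClosure _ hx⟩ hx)
      rw [coe_restrictHom] at this
      exact Subtype.ext this
    · refine aux ⟨x, IntermediateField.le_normalClosure _ (le_sup_right (b := L₂) hx)⟩ ?_
      have := congrArg Subtype.val (h2 ⟨x, IntermediateField.le_normalClosure _ hx⟩ hx)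
      rw [coe_restrictHom] at this
      exact Subtype.ext this
  rw [mem_stab]
  intro x hx
  have := key hx
  rw [IntermediateField.mem_lift, IntermediateField.mem_fixedField_iff] at this
  exact this _ (Subgroup.mem_zpowers _)

theorem isGalois_nc (L : IntermediateField K Kbar) [FiniteDimensional K L]
    [Algebra.IsSeparable K L] : IsGalois K (nc L) :=
  haveI : Normal K Kbar := IsAlgClosure.normal K Kbar
  { to_isSeparable := by
      have : nc L ≤ separableClosure K Kbar :=
        (IntermediateField.normalClosure_mono _ _ (le_separableClosure K Kbar L)).trans
          (separableClosure.normalClosure_eq_self K Kbar).le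
      exact (le_separableClosure_iff K Kbar _).1 this
    to_normal := inferInstance }

theorem card_cosets (L : IntermediateField K Kbar) [FiniteDimensional K L]
    [Algebra.IsSeparable K L] : Nat.card (Cosets L) = Module.finrank K L := by
  have := isGalois_nc L
  have h1 := (stab L).card_eq_card_quotient_mul_card_subgroup
  rw [IsGalois.card_aut_eq_finrank, IsGalois.card_fixingSubgroup_eq_finrank] at h1
  have h2 := Module.finrank_mul_finrank K
    (IntermediateField.restrict L.le_normalClosure) (nc L)
  have h3 : Module.finrank K (IntermediateField.restrict (L.le_normalClosure (F := K)))
      = Module.finrank K L :=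
    (IntermediateField.restrictAlgEquiv L.le_normalClosure).toLinearEquiv.finrank_eq.symm
  have h4 : 0 < Module.finrank (IntermediateField.restrict (L.le_normalClosure (F := K)))
    (nc L) := Module.finrank_pos
  rw [h3] at h2
  exact (Nat.eq_of_mul_eq_mul_right h4 (h2.trans h1)).symm

variable {L₁ L₂}
variable [FiniteDimensional K L₁] [FiniteDimensional K L₂]
  [Algebra.IsSeparable K L₁] [Algebra.IsSeparable K L₂]

theorem psi_bijective (h : L₁.LinearDisjoint L₂) : Function.Bijective (psi L₁ L₂) := by
  have : Finite (Cosets L₁) := Quotient.finite _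
  have : Finite (Cosets L₂) := Quotient.finite _
  refine (Nat.bijective_iff_injective_and_card _).2 ⟨psi_injective L₁ L₂, ?_⟩
  rw [Nat.card_prod, card_cosets, card_cosets, card_cosets, h.finrank_sup]

/-- The bijection `ψ`, for linearly disjoint `L₁`, `L₂`. -/
noncomputable def psiEquiv (h : L₁.LinearDisjoint L₂) :
    Cosets (L₁ ⊔ L₂) ≃ Cosets L₁ × Cosets L₂ :=
  Equiv.ofBijective _ (psi_bijective h)

/-- The map `ι : Perm(G₁/G₁') × Perm(G₂/G₂') → Perm(G/G')`,
`ι(φ₁, φ₂)(x) = ψ⁻¹(φ₁(ψ(x)₁), φ₂(ψ(x)₂))`. -/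
noncomputable def iota (h : L₁.LinearDisjoint L₂) :
    Equiv.Perm (Cosets L₁) × Equiv.Perm (Cosets L₂) →* Equiv.Perm (Cosets (L₁ ⊔ L₂)) where
  toFun p := (psiEquiv h).trans ((Equiv.prodCongr p.1 p.2).trans (psiEquiv h).symm)
  map_one' := by ext x; simp
  map_mul' p q := by ext x; simp [Prod.map]

theorem psiEquiv_iota (h : L₁.LinearDisjoint L₂)
    (p : Equiv.Perm (Cosets L₁) × Equiv.Perm (Cosets L₂)) (x : Cosets (L₁ ⊔ L₂)) :
    psiEquiv h (iota h p x) = (p.1 (psiEquiv h x).1, p.2 (psiEquiv h x).2) := by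
  simp [iota, Prod.map]

theorem leftTranslation_eq_iota (h : L₁.LinearDisjoint L₂) (g : Gal(nc (L₁ ⊔ L₂)/K)) :
    leftTranslation (L₁ ⊔ L₂) g = iota h
      (leftTranslation L₁ (restrictHom (IntermediateField.normalClosure_mono _ _ le_sup_left) g),
        leftTranslation L₂
          (restrictHom (IntermediateField.normalClosure_mono _ _ le_sup_right) g)) := by
  ext x
  apply (psiEquiv h).injective
  rw [psiEquiv_iota]
  induction x using QuotientGroup.induction_on with | _ a
  change (restrictCoset le_sup_left ((g * a : Gal(nc (L₁ ⊔ L₂)/K)) : Cosets (L₁ ⊔ L₂)),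
    restrictCoset le_sup_right ((g * a : Gal(nc (L₁ ⊔ L₂)/K)) : Cosets (L₁ ⊔ L₂))) = _
  rw [restrictCoset_mk, restrictCoset_mk, map_mul, map_mul]
  rfl

/-- The permutation subgroup `ι(N₁ × N₂)`. -/
noncomputable def RegularSubgroup.prod (N₁ : RegularSubgroup L₁) (N₂ : RegularSubgroup L₂)
    (h : L₁.LinearDisjoint L₂) : RegularSubgroup (L₁ ⊔ L₂) where
  carrier := (N₁.carrier.prod N₂.carrier).map (iota h)
  regular x y := by
    obtain ⟨a, ha, ha'⟩ := N₁.regular (psiEquiv h x).1 (psiEquiv h y).1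
    obtain ⟨b, hb, hb'⟩ := N₂.regular (psiEquiv h x).2 (psiEquiv h y).2
    refine ⟨⟨iota h (a, b), Subgroup.mem_map_of_mem _ ⟨a.2, b.2⟩⟩, ?_, ?_⟩
    · apply (psiEquiv h).injective
      rw [psiEquiv_iota]
      exact Prod.ext ha hb
    · rintro ⟨_, ⟨⟨c, d⟩, ⟨hc, hd⟩, rfl⟩⟩ hcd
      have := congrArg (psiEquiv h) hcd
      simp only [psiEquiv_iota] at this
      have h1 := ha' ⟨c, hc⟩ (congrArg Prod.fst this)
      have h2 := hb' ⟨d, hd⟩ (congrArg Prod.snd this)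
      subst h1 h2
      rfl
  normalized := by
    rintro g _ ⟨⟨c, d⟩, ⟨hc, hd⟩, rfl⟩
    rw [leftTranslation_eq_iota h, ← map_mul, ← map_inv, ← map_mul]
    exact Subgroup.mem_map_of_mem _ ⟨N₁.normalized _ _ hc, N₂.normalized _ _ hd⟩

/-- The map `N₁ × N₂ → ι(N₁ × N₂)`. -/
noncomputable def RegularSubgroup.iotaMk (N₁ : RegularSubgroup L₁) (N₂ : RegularSubgroup L₂)
    (h : L₁.LinearDisjoint L₂) (η₁ : N₁.carrier) (η₂ : N₂.carrier) : (N₁.prod N₂ h).carrier :=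
  ⟨iota h (η₁, η₂), Subgroup.mem_map_of_mem _ ⟨η₁.2, η₂.2⟩⟩

/-- The product `∑ᵢ ∑ⱼ hᵢ hⱼ' ι(ηᵢ, ηⱼ')` in `L̃[ι(N₁ × N₂)]` of the elements `∑ᵢ hᵢ ηᵢ` of `L̃₁[N₁]`
and `∑ⱼ hⱼ' ηⱼ'` of `L̃₂[N₂]`. -/
noncomputable def groupAlgebraProd {N₁ : RegularSubgroup L₁} {N₂ : RegularSubgroup L₂}
    (h : L₁.LinearDisjoint L₂) (x₁ : N₁.GroupAlgebra) (x₂ : N₂.GroupAlgebra) :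
    (N₁.prod N₂ h).GroupAlgebra :=
  x₁.coeff.sum fun η₁ c₁ => x₂.coeff.sum fun η₂ c₂ =>
    MonoidAlgebra.single (N₁.iotaMk N₂ h η₁ η₂)
      (IntermediateField.inclusion
          (IntermediateField.normalClosure_mono L₁ (L₁ ⊔ L₂) le_sup_left) c₁ *
        IntermediateField.inclusion
          (IntermediateField.normalClosure_mono L₂ (L₁ ⊔ L₂) le_sup_right) c₂)

end Product

end GreitherPareigis

/-! Linear disjointness identifies `L₁ ⊗ L₂` with `L` by multiplication. Since `λ(g)` is the image
under `ι` of the left translations by the two restrictions of `g`, the product of a fixed element of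
`L̃₁[N₁]` and a fixed element of `L̃₂[N₂]` is fixed in `L̃[N]`. This yields `f : H₁ ⊗ H₂ → H`, and
`f (h₁ ⊗ h₂)` acts on `L₁ ⊗ L₂` factor by factor. Faithfulness of the actions makes `f` injective,
and a dimension count makes it bijective.

Coprimality of the discriminants gives `𝒪_L = 𝒪_{L₁} ⊗ 𝒪_{L₂}`: the discriminant of either factor is
a denominator for the coordinates of an integral element in the product basis, so coprime
discriminants leave no denominator (`tensorProduct_repr_mem_range_of_isCoprime`).

The claim on orders is then lattice theory. Inside `End(L₁) ⊗ End(L₂)`, the order `𝔄_H` consists of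
the elements of `H₁ ⊗ H₂` preserving `𝒪_{L₁} ⊗ 𝒪_{L₂}`. Each `𝔄_{Hᵢ}` is the intersection of a
subspace with the lattice `End(𝒪_{Lᵢ})`, so the quotient is torsion-free and, over a principal ideal
domain, the inclusion splits. The tensor product of the two retractions fixes `H₁ ⊗ H₂` and sends
integral matrices into `𝔄_{H₁} ⊗ 𝔄_{H₂}` (`Submodule.mem_range_tensorToTensor_of_preserving`).
Freeness follows because products of basis elements of `𝒪_{L₁}` and `𝒪_{L₂}` form a basis over
`𝔄_{H₁} ⊗ 𝔄_{H₂} ≅ 𝔄_H`. -/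

/-! ### Lattices over a principal ideal domain and their tensor products. -/

section Lattices

variable {O K : Type*} [CommRing O] [IsDomain O] [IsPrincipalIdealRing O] [Field K] [Algebra O K]
  [IsFractionRing O K]

/-- The canonical map `A ⊗_O B → V ⊗_K W` for `O`-submodules `A`, `B` of the `K`-spaces `V`, `W`. -/
noncomputable def Submodule.tensorToTensor {O K V W : Type*} [CommRing O] [Field K] [Algebra O K]
    [AddCommGroup V] [Module K V] [Module O V] [IsScalarTower O K V]
    [AddCommGroup W] [Module K W] [Module O W] [IsScalarTower O K W]
    (A : Submodule O V) (B : Submodule O W) : A ⊗[O] B →ₗ[O] V ⊗[K] W :=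
  TensorProduct.mapOfCompatibleSMul K O O V W ∘ₗ TensorProduct.map A.subtype B.subtype

theorem Submodule.tensorToTensor_tmul {O K V W : Type*} [CommRing O] [Field K] [Algebra O K]
    [AddCommGroup V] [Module K V] [Module O V] [IsScalarTower O K V]
    [AddCommGroup W] [Module K W] [Module O W] [IsScalarTower O K W]
    (A : Submodule O V) (B : Submodule O W) (a : A) (b : B) :
    A.tensorToTensor (K := K) B (a ⊗ₜ b) = (a : V) ⊗ₜ[K] (b : W) := rfl

section

variable {V W : Type*} [AddCommGroup V] [Module K V] [Module O V] [IsScalarTower O K V]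
    [AddCommGroup W] [Module K W] [Module O W] [IsScalarTower O K W]

-- Torsion-free modules over a principal ideal domain are flat, so `A ⊗ B` embeds in `V ⊗[O] W`; the
-- latter equals `V ⊗[K] W` because `K` is a localization of `O`.
variable (K) in
theorem Submodule.tensorToTensor_injective (A : Submodule O V) (B : Submodule O W) :
    Function.Injective (A.tensorToTensor (K := K) B) := by
  have hV : Module.IsTorsionFree O V := .trans_faithfulSMul O K V
  have hW : Module.IsTorsionFree O W := .trans_faithfulSMul O K W
  have := IsLocalization.tensorProduct_compatibleSMul (nonZeroDivisors O) K V W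
  have h := (TensorProduct.equivOfCompatibleSMul K O O V W).injective
  exact h.comp (TensorProduct.map_injective_of_flat_flat _ _ A.subtype_injective
    B.subtype_injective)

/-- A subspace of a space with a lattice has a projection that preserves the lattice. -/
theorem Module.Basis.exists_projection_preserving_span {ι : Type*} [Finite ι]
    (b : Module.Basis ι K V) (U : Submodule K V) :
    ∃ R : V →ₗ[K] V, (∀ u ∈ U, R u = u) ∧ (∀ v, R v ∈ U) ∧
      ∀ i, R (b i) ∈ Submodule.span O (Set.range b) := by
  have hV : Module.IsTorsionFree O V := .trans_faithfulSMul O K V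
  set S := Submodule.span O (Set.range b) with hS
  have hbS : ∀ i, b i ∈ S := fun i => Submodule.subset_span ⟨i, rfl⟩
  have : Module.Finite O S := Module.Finite.span_of_finite O (Set.finite_range b)
  let T : Submodule O S := (U.restrictScalars O).comap S.subtype
  have hT : ∀ x : S, x ∈ T ↔ (x : V) ∈ U := fun x => Iff.rfl
  -- `T` is cut out by a `K`-subspace, where nonzero scalars of `O` can be cancelled.
  have tf : Module.IsTorsionFree O (S ⧸ T) := by
    refine .of_smul_eq_zero ?_
    intro r x hx
    induction x using Submodule.Quotient.induction_on with | _ x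
    rw [← Submodule.Quotient.mk_smul, Submodule.Quotient.mk_eq_zero, hT] at hx
    by_cases hr : r = 0
    · exact Or.inl hr
    right
    rw [Submodule.Quotient.mk_eq_zero, hT]
    rw [Submodule.coe_smul, ← algebraMap_smul K r] at hx
    exact (U.smul_mem_iff (by simpa using hr)).1 hx
  -- A finitely generated torsion-free module over a principal ideal domain is free, hence
  -- projective, so the quotient map has a section `s`, and `1 - s ∘ mkQ` retracts the lattice onto
  -- `T`.
  obtain ⟨s, hs⟩ := Module.projective_lifting_property T.mkQ LinearMap.id T.mkQ_surjective
  let r : S →ₗ[O] S := LinearMap.id - s ∘ₗ T.mkQ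
  have hr1 : ∀ x, r x ∈ T := by
    intro x
    rw [← Submodule.Quotient.mk_eq_zero]
    have := LinearMap.congr_fun hs (T.mkQ x)
    simp only [LinearMap.comp_apply, LinearMap.id_apply] at this
    change T.mkQ (x - s (T.mkQ x)) = 0
    rw [map_sub, this, sub_self]
  have hr2 : ∀ x ∈ T, r x = x := by
    intro x hx
    have : T.mkQ x = 0 := by simpa using hx
    simp [r, this]
  let R : V →ₗ[K] V := b.constr K fun i => (r ⟨b i, hbS i⟩ : V)
  have hRb : ∀ i, R (b i) = r ⟨b i, hbS i⟩ := fun i => b.constr_basis K _ i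
  have hRS : ∀ x : S, R x = r x := by
    rintro ⟨x, hx⟩
    induction hx using Submodule.span_induction with
    | mem x h => obtain ⟨i, rfl⟩ := h; exact hRb i
    | zero => exact (map_zero R).trans (by simp [show (⟨0, _⟩ : S) = 0 from rfl])
    | add x y hx hy h1 h2 =>
      have := congrArg Subtype.val (map_add r ⟨x, hx⟩ ⟨y, hy⟩)
      exact (map_add R x y).trans ((congrArg₂ _ h1 h2).trans this.symm)
    | smul a x hx h =>
      have := congrArg Subtype.val (map_smul r a ⟨x, hx⟩)
      exact (R.map_smul_of_tower a x).trans ((congrArg _ h).trans this.symm)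
  refine ⟨R, ?_, ?_, ?_⟩
  · intro u hu
    -- `R` is known to fix only the lattice points of `U`; a common denominator of the coordinates
    -- moves `u` into the lattice.
    obtain ⟨d, hd⟩ := IsLocalization.exist_integer_multiples_of_finite (nonZeroDivisors O)
      (fun i => b.repr u i)
    have hdu : (d : O) • u ∈ S := by
      rw [hS, b.mem_span_iff_repr_mem O]
      intro i
      obtain ⟨z, hz⟩ := hd i
      refine ⟨z, hz.trans ?_⟩
      rw [← algebraMap_smul K (d : O) u, map_smul, Finsupp.smul_apply, algebraMap_smul]
    have h1 := hRS ⟨_, hdu⟩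
    have hT' : (d : O) • u ∈ U := by
      rw [← algebraMap_smul K (d : O) u]
      exact U.smul_mem _ hu
    rw [hr2 ⟨_, hdu⟩ hT'] at h1
    have hd0 : algebraMap O K d ≠ 0 := by simp
    change R ((d : O) • u) = (d : O) • u at h1
    rw [← algebraMap_smul K (d : O) u, map_smul] at h1
    exact smul_right_injective V hd0 h1
  · intro v
    rw [← b.linearCombination_repr v, Finsupp.linearCombination_apply, Finsupp.sum, map_sum]
    refine U.sum_mem fun i _ => ?_
    rw [map_smul, hRb]
    exact U.smul_mem _ (hr1 _)
  · intro i
    rw [hRb]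
    exact (r _).2

/-- If `A` is the set of elements of `H` that preserve the lattice spanned by `b`, then a faithful
representation `H → End(V)` has a retraction mapping all matrix units into `A`. -/
theorem Module.Basis.exists_retraction_of_preserving {H ι : Type*} [AddCommGroup H] [Module K H]
    [Module O H] [IsScalarTower O K H] [Fintype ι] [DecidableEq ι] (b : Module.Basis ι K V)
    (ρ : H →ₗ[K] Module.End K V) (hρ : Function.Injective ρ) (A : Submodule O H)
    (hA : ∀ h, (∀ i j, b.repr (ρ h (b i)) j ∈ Set.range (algebraMap O K)) → h ∈ A) :
    ∃ R : Module.End K V →ₗ[K] H, (∀ h, R (ρ h) = h) ∧ ∀ ij, R (b.linearMap b ij) ∈ A := by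
  obtain ⟨R, hR1, hR2, hR3⟩ := (b.linearMap b).exists_projection_preserving_span (O := O)
    (LinearMap.range ρ)
  let e := LinearEquiv.ofInjective ρ hρ
  have he : ∀ x, ρ (e.symm x) = x := fun x => by
    rw [← LinearEquiv.ofInjective_apply ρ (h := hρ)]
    exact congrArg Subtype.val (e.apply_symm_apply x)
  refine ⟨e.symm.toLinearMap ∘ₗ R.codRestrict _ hR2, ?_, ?_⟩
  · intro h
    apply hρ
    exact (he _).trans (hR1 _ ⟨h, rfl⟩)
  · intro ij
    apply hA
    intro i j
    have h1 : ρ ((e.symm.toLinearMap ∘ₗ R.codRestrict _ hR2) (b.linearMap b ij)) =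
      R (b.linearMap b ij) := he _
    rw [h1]
    have h2 := ((b.linearMap b).mem_span_iff_repr_mem O _).1 (hR3 ij) (j, i)
    rw [Module.Basis.linearMap_repr_apply] at h2
    simpa [Matrix.stdBasis, LinearMap.toMatrix_apply] using h2

/-- The retractions `R₁`, `R₂` give `t = (R₁ ⊗ R₂)(X)`, where `X` is the operator of `t`.
Integrality of its matrix writes `X` as an `O`-combination of tensors of matrix units, and each of
these is sent into `A₁ ⊗ A₂`. -/
theorem Submodule.mem_range_tensorToTensor_of_preserving {H₁ H₂ ι κ : Type*}
    [AddCommGroup H₁] [Module K H₁] [Module O H₁] [IsScalarTower O K H₁]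
    [AddCommGroup H₂] [Module K H₂] [Module O H₂] [IsScalarTower O K H₂]
    [Finite ι] [Finite κ] (b : Module.Basis ι K V) (c : Module.Basis κ K W)
    (ρ₁ : H₁ →ₗ[K] Module.End K V) (hρ₁ : Function.Injective ρ₁)
    (ρ₂ : H₂ →ₗ[K] Module.End K W) (hρ₂ : Function.Injective ρ₂)
    (A₁ : Submodule O H₁)
    (hA₁ : ∀ h, (∀ i j, b.repr (ρ₁ h (b i)) j ∈ Set.range (algebraMap O K)) → h ∈ A₁)
    (A₂ : Submodule O H₂)
    (hA₂ : ∀ h, (∀ i j, c.repr (ρ₂ h (c i)) j ∈ Set.range (algebraMap O K)) → h ∈ A₂)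
    (t : H₁ ⊗[K] H₂)
    (ht : ∀ i j, (b.tensorProduct c).repr (TensorProduct.homTensorHomMap (RingHom.id K) V W V W
      (TensorProduct.map ρ₁ ρ₂ t) (b.tensorProduct c i)) j ∈ Set.range (algebraMap O K)) :
    t ∈ LinearMap.range (A₁.tensorToTensor (K := K) A₂) := by
  classical
  have := Fintype.ofFinite ι
  have := Fintype.ofFinite κ
  obtain ⟨R₁, hR₁, hR₁'⟩ := b.exists_retraction_of_preserving ρ₁ hρ₁ A₁ hA₁
  obtain ⟨R₂, hR₂, hR₂'⟩ := c.exists_retraction_of_preserving ρ₂ hρ₂ A₂ hA₂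
  set X := TensorProduct.map ρ₁ ρ₂ t with hX
  have htX : t = TensorProduct.map R₁ R₂ X := by
    rw [hX, ← LinearMap.comp_apply, ← TensorProduct.map_comp,
      show R₁ ∘ₗ ρ₁ = LinearMap.id from LinearMap.ext hR₁,
      show R₂ ∘ₗ ρ₂ = LinearMap.id from LinearMap.ext hR₂, TensorProduct.map_id,
      LinearMap.id_apply]
  set B := (b.linearMap b).tensorProduct (c.linearMap c) with hB
  -- Tensors of matrix units are the matrix units of the product basis; within each pair the first
  -- index is the row and the second the column.
  have key : ∀ (Y : Module.End K V ⊗[K] Module.End K W) (p : (ι × ι) × (κ × κ)), B.repr Y p =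
      (b.tensorProduct c).repr (TensorProduct.homTensorHomMap (RingHom.id K) V W V W Y
        (b.tensorProduct c (p.1.2, p.2.2))) (p.1.1, p.2.1) := by
    rintro Y ⟨⟨i, j⟩, ⟨k, l⟩⟩
    induction Y with
    | zero => simp
    | add x y hx hy => simp only [map_add, Finsupp.add_apply, hx, hy, LinearMap.add_apply]
    | tmul φ ψ =>
      rw [hB, Module.Basis.tensorProduct_repr_tmul_apply, Module.Basis.tensorProduct_apply,
        TensorProduct.homTensorHomMap_apply, TensorProduct.map_tmul,
        Module.Basis.tensorProduct_repr_tmul_apply, Module.Basis.linearMap_repr_apply,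
        Module.Basis.linearMap_repr_apply]
      simp [Matrix.stdBasis, LinearMap.toMatrix_apply]
  rw [htX, ← B.sum_repr X, map_sum]
  refine Submodule.sum_mem _ fun p _ => ?_
  obtain ⟨z, hz⟩ := ht (p.1.2, p.2.2) (p.1.1, p.2.1)
  rw [key, ← hz, algebraMap_smul, hB, LinearMap.map_smul_of_tower]
  refine Submodule.smul_mem _ _ ⟨⟨_, hR₁' p.1⟩ ⊗ₜ ⟨_, hR₂' p.2⟩, ?_⟩
  rw [Submodule.tensorToTensor_tmul, Module.Basis.tensorProduct_apply, TensorProduct.map_tmul]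

end

end Lattices

/-! ### Integral bases and discriminants. -/

section IntegralBases

open scoped Matrix

variable (O K : Type*) [CommRing O] [IsDomain O] [IsPrincipalIdealRing O] [Field K] [Algebra O K]
  [IsFractionRing O K]

theorem Algebra.trace_one_tmul {K : Type*} [Field K] (F : Type*) {E : Type*} [Field F] [Field E]
    [Algebra K F] [Algebra K E] [FiniteDimensional K E] (z : E) :
    Algebra.trace F (F ⊗[K] E) (1 ⊗ₜ z) = algebraMap K F (Algebra.trace K E z) := by
  rw [Algebra.trace_apply, Algebra.trace_apply, ← LinearMap.trace_baseChange]
  congr 1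
  ext
  simp

/-- The integral closure of a principal ideal domain in a finite separable extension has an
integral basis. -/
theorem exists_integral_basis (L : Type*) [Field L] [Algebra K L] [Algebra O L]
    [IsScalarTower O K L] [FiniteDimensional K L] [Algebra.IsSeparable K L] :
    ∃ b : Module.Basis (Fin (Module.finrank K L)) K L, (∀ i, IsIntegral O (b i)) ∧
      ∀ y, IsIntegral O y → ∀ i, b.repr y i ∈ Set.range (algebraMap O K) := by
  have : Module.IsTorsionFree O L := .trans_faithfulSMul O K L
  have : Module.Free O (integralClosure O L) :=
    IsIntegralClosure.module_free O K L (integralClosure O L)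
  have : Module.Finite O (integralClosure O L) :=
    IsIntegralClosure.finite O K L (integralClosure O L)
  have : IsLocalization (Algebra.algebraMapSubmonoid (integralClosure O L) (nonZeroDivisors O)) L :=
    IsIntegralClosure.isLocalization O K L (integralClosure O L)
  let b₀ := Module.finBasisOfFinrankEq O (integralClosure O L)
    (IsIntegralClosure.rank O K L (integralClosure O L))
  refine ⟨b₀.localizationLocalization K (nonZeroDivisors O) L, fun i => ?_, fun y hy i => ?_⟩
  · rw [Module.Basis.localizationLocalization_apply]
    exact (b₀ i).2
  · have := b₀.localizationLocalization_repr_algebraMap K (nonZeroDivisors O) L ⟨y, hy⟩ i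
    exact ⟨_, this.symm⟩

variable {O K}

-- A family of integral elements is obtained from `b` by a matrix `P` over `O`, so its discriminant
-- is `det P ^ 2` times that of `b`.
omit [IsDomain O] [IsPrincipalIdealRing O] in
theorem discriminantIdeal_le_span {L : Type*} [Field L] [Algebra K L] [Algebra O L]
    [IsScalarTower O K L] (b : Module.Basis (Fin (Module.finrank K L)) K L)
    (hb : ∀ y, IsIntegral O y → ∀ i, b.repr y i ∈ Set.range (algebraMap O K)) (d : O)
    (hd : algebraMap O K d = Algebra.discr K b) :
    discriminantIdeal O K L ≤ Ideal.span {d} := by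
  refine Ideal.span_le.2 ?_
  rintro x ⟨b', hx⟩
  choose P hP using fun i j => hb (b' i) (b' i).2 j
  refine Ideal.mem_span_singleton'.2 ⟨(Matrix.of P).det ^ 2, ?_⟩
  apply IsFractionRing.injective O K
  have h : (fun i => (b' i : L)) =
      ((Matrix.of P).map (algebraMap O K)).map (algebraMap K L) *ᵥ b := by
    ext i
    conv_lhs => rw [← b.sum_repr (b' i : L)]
    refine Finset.sum_congr rfl fun j _ => ?_
    rw [← hP, Algebra.smul_def]
    rfl
  rw [hx, h, Algebra.discr_of_matrix_mulVec, map_mul, map_pow, hd, RingHom.map_det]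
  rfl

theorem Algebra.TensorProduct.tensorProduct_repr_apply {F E κ ι : Type*} [Field F] [Field E]
    [Algebra K F] [Algebra K E] (c : Module.Basis κ K F) (b : Module.Basis ι K E) (x : F ⊗[K] E)
    (k : κ) (i : ι) :
    (c.tensorProduct b).repr x (k, i) =
      c.repr ((Algebra.TensorProduct.basis F b).repr x i) k := by
  induction x with
  | zero => simp
  | add x y hx hy => simp only [map_add, Finsupp.add_apply, hx, hy]
  | tmul x y =>
    rw [Module.Basis.tensorProduct_repr_tmul_apply, Algebra.TensorProduct.basis_repr_tmul,
      Finsupp.smul_apply, Finsupp.mapRange_apply, smul_eq_mul, smul_eq_mul, mul_comm x, ← Algebra.smul_def,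
      map_smul, Finsupp.smul_apply, smul_eq_mul]

/-- The discriminant of an integral basis of `E/K` is a denominator for the coordinates of the
integral elements of `F ⊗ E`. -/
theorem discr_mul_repr_mem_range {F E L κ ι : Type*} [Field F] [Field E] [Field L]
    [Algebra K F] [Algebra K E] [Algebra O F] [Algebra O E] [IsScalarTower O K F]
    [IsScalarTower O K E] [Algebra F L] [Algebra O L] [IsScalarTower O F L]
    [FiniteDimensional K E] [Fintype ι] [DecidableEq ι]
    (e : F ⊗[K] E ≃ₐ[F] L) (c : Module.Basis κ K F) (b : Module.Basis ι K E)
    (hb : ∀ i, IsIntegral O (b i))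
    (hc : ∀ y, IsIntegral O y → ∀ k, c.repr y k ∈ Set.range (algebraMap O K))
    (x : F ⊗[K] E) (hx : IsIntegral O (e x)) (k : κ) (i : ι) :
    Algebra.discr K b * (c.tensorProduct b).repr x (k, i) ∈ Set.range (algebraMap O K) := by
  have : FiniteDimensional F L := Module.Finite.equiv e.toLinearEquiv
  have heb : ∀ j, IsIntegral O (e (1 ⊗ₜ b j)) := by
    intro j
    let _ : Algebra K L := ((algebraMap F L).comp (algebraMap K F)).toAlgebra
    have : IsScalarTower K F L := .of_algebraMap_eq fun _ => rfl
    have : IsScalarTower O K L := .of_algebraMap_eq fun r => by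
      rw [IsScalarTower.algebraMap_apply O F L, IsScalarTower.algebraMap_apply O K F]
      rfl
    exact (hb j).map (((e.toAlgHom.restrictScalars K).comp
      Algebra.TensorProduct.includeRight).restrictScalars O)
  have htr : ∀ i j, IsIntegral O (Algebra.trace K E (b i * b j)) := fun i j =>
    Algebra.isIntegral_trace ((hb i).mul (hb j))
  choose T hT using fun i j => IsIntegrallyClosed.isIntegral_iff.1 (htr i j)
  -- The traces of `e x` against the `b j` give a linear system for the `F`-coordinates `y`, whose
  -- matrix is the trace matrix of `b`, with determinant the discriminant.
  set y := (Algebra.TensorProduct.basis F b).repr x with hy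
  have hxy : x = ∑ i, y i • (1 ⊗ₜ b i : F ⊗[K] E) := by
    conv_lhs => rw [← (Algebra.TensorProduct.basis F b).sum_repr x]
    simp [hy]
  let M : Matrix ι ι F := (Matrix.of T).map (algebraMap O F)
  have hM : ∀ j, IsIntegral O ((M *ᵥ y) j) := by
    intro j
    have h1 : Algebra.trace F L (e (1 ⊗ₜ b j) * e x) = (M *ᵥ y) j := by
      rw [← map_mul, Algebra.trace_eq_of_algEquiv, hxy, Finset.mul_sum, map_sum]
      refine Finset.sum_congr rfl fun i _ => ?_
      rw [mul_smul_comm, Algebra.TensorProduct.tmul_mul_tmul, map_smul, mul_one,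
        Algebra.trace_one_tmul, smul_eq_mul, mul_comm, ← hT, ← IsScalarTower.algebraMap_apply]
      rfl
    rw [← h1]
    exact Algebra.isIntegral_trace ((heb j).mul hx)
  -- Cramer's rule: `M` has entries from `O`, so its adjugate does too, and `det M • y` is integral
  -- along with `M *ᵥ y`.
  have hadj : M.adjugate *ᵥ (M *ᵥ y) = M.det • ⇑y := by
    rw [Matrix.mulVec_mulVec, Matrix.adjugate_mul, Matrix.smul_mulVec, Matrix.one_mulVec]
  have hint : IsIntegral O (M.det * y i) := by
    have h1 := congrFun hadj i
    rw [Pi.smul_apply, smul_eq_mul] at h1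
    rw [← h1]
    refine IsIntegral.sum _ fun j _ => (?_ : IsIntegral O (M.adjugate i j)).mul (hM j)
    have h2 : M.adjugate = (Matrix.of T).adjugate.map (algebraMap O F) :=
      ((algebraMap O F).map_adjugate _).symm
    rw [h2]
    exact isIntegral_algebraMap
  have hdet : M.det = algebraMap K F (Algebra.discr K b) := by
    have h1 : Algebra.traceMatrix K b = (Matrix.of T).map (algebraMap O K) := by
      ext i j
      rw [Algebra.traceMatrix_apply, Algebra.traceForm_apply, ← hT]
      rfl
    rw [Algebra.discr_def, h1]
    change ((algebraMap O F).mapMatrix (Matrix.of T)).det =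
      algebraMap K F ((algebraMap O K).mapMatrix (Matrix.of T)).det
    rw [← RingHom.map_det, ← RingHom.map_det, ← IsScalarTower.algebraMap_apply]
  have h3 := hc _ hint k
  rw [hdet, ← Algebra.smul_def, map_smul, Finsupp.smul_apply, smul_eq_mul] at h3
  rwa [Algebra.TensorProduct.tensorProduct_repr_apply]

/-- For extensions with coprime discriminants, the tensor products of the elements of integral
bases form an integral basis. -/
theorem tensorProduct_repr_mem_range_of_isCoprime {L₁ L₂ L : Type*} [Field L₁] [Field L₂] [Field L]
    [Algebra K L₁] [Algebra K L₂] [Algebra K L] [Algebra O L₁] [Algebra O L₂] [Algebra O L]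
    [IsScalarTower O K L₁] [IsScalarTower O K L₂] [IsScalarTower O K L]
    [FiniteDimensional K L₁] [FiniteDimensional K L₂]
    (h : IsCoprime (discriminantIdeal O K L₁) (discriminantIdeal O K L₂))
    (e : L₁ ⊗[K] L₂ ≃ₐ[K] L) (b : Module.Basis (Fin (Module.finrank K L₁)) K L₁)
    (c : Module.Basis (Fin (Module.finrank K L₂)) K L₂)
    (hb : ∀ i, IsIntegral O (b i))
    (hb' : ∀ y, IsIntegral O y → ∀ k, b.repr y k ∈ Set.range (algebraMap O K))
    (hc : ∀ i, IsIntegral O (c i))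
    (hc' : ∀ y, IsIntegral O y → ∀ k, c.repr y k ∈ Set.range (algebraMap O K))
    (x : L₁ ⊗[K] L₂) (hx : IsIntegral O (e x)) (p) :
    (b.tensorProduct c).repr x p ∈ Set.range (algebraMap O K) := by
  obtain ⟨i, k⟩ := p
  obtain ⟨d₁, hd₁⟩ := IsIntegrallyClosed.isIntegral_iff.1
    (Algebra.discr_isIntegral (R := O) K hb)
  obtain ⟨d₂, hd₂⟩ := IsIntegrallyClosed.isIntegral_iff.1
    (Algebra.discr_isIntegral (R := O) K hc)
  have h1 : algebraMap O K d₁ * (b.tensorProduct c).repr x (i, k) ∈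
      Set.range (algebraMap O K) := by
    -- To obtain the discriminant of `L₁/K` as a denominator, `L₂` must be the base field `F`, so
    -- the tensor factors are swapped.
    let _ : Algebra L₂ L := (e.toAlgHom.comp Algebra.TensorProduct.includeRight).toAlgebra
    have : IsScalarTower K L₂ L := .of_algebraMap_eq fun r =>
      ((e.toAlgHom.comp Algebra.TensorProduct.includeRight).commutes r).symm
    have : IsScalarTower O L₂ L := .of_algebraMap_eq fun r => by
      rw [IsScalarTower.algebraMap_apply O K L, IsScalarTower.algebraMap_apply O K L₂,
        ← IsScalarTower.algebraMap_apply K]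
    let e' : L₂ ⊗[K] L₁ ≃ₐ[L₂] L :=
      AlgEquiv.ofRingEquiv (f := ((Algebra.TensorProduct.comm K L₂ L₁).trans e).toRingEquiv)
        fun r => by
          change e (Algebra.TensorProduct.comm K L₂ L₁ (r ⊗ₜ 1)) = _
          rw [Algebra.TensorProduct.comm_tmul]
          rfl
    have h2 := discr_mul_repr_mem_range e' c b hb hc' (Algebra.TensorProduct.comm K L₁ L₂ x)
      (by
        change IsIntegral O (e (Algebra.TensorProduct.comm K L₂ L₁
          (Algebra.TensorProduct.comm K L₁ L₂ x)))
        rwa [← Algebra.TensorProduct.comm_symm, AlgEquiv.symm_apply_apply]) k i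
    rw [hd₁]
    convert! h2 using 2
    clear h2 hx
    induction x with
    | zero => simp
    | add x y hx hy => simp only [map_add, Finsupp.add_apply, hx, hy]
    | tmul x y =>
      rw [Algebra.TensorProduct.comm_tmul, Module.Basis.tensorProduct_repr_tmul_apply,
        Module.Basis.tensorProduct_repr_tmul_apply, smul_eq_mul, smul_eq_mul, mul_comm]
  have h2 : algebraMap O K d₂ * (b.tensorProduct c).repr x (i, k) ∈
      Set.range (algebraMap O K) := by
    let _ : Algebra L₁ L := (e.toAlgHom.comp Algebra.TensorProduct.includeLeft).toAlgebra
    have : IsScalarTower K L₁ L := .of_algebraMap_eq fun r =>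
      ((e.toAlgHom.comp Algebra.TensorProduct.includeLeft).commutes r).symm
    have : IsScalarTower O L₁ L := .of_algebraMap_eq fun r => by
      rw [IsScalarTower.algebraMap_apply O K L, IsScalarTower.algebraMap_apply O K L₁,
        ← IsScalarTower.algebraMap_apply K]
    let e' : L₁ ⊗[K] L₂ ≃ₐ[L₁] L := AlgEquiv.ofRingEquiv (f := e.toRingEquiv) fun r => rfl
    rw [hd₂]
    exact discr_mul_repr_mem_range e' b c hc hb' x hx i k
  -- The principal ideals contain the discriminant ideals, so they inherit coprimality. A relation
  -- `u * d₁ + v * d₂ = 1` then clears both denominators.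
  have h3 : IsCoprime (Ideal.span {d₁}) (Ideal.span {d₂}) := by
    rw [Ideal.isCoprime_iff_sup_eq, eq_top_iff, ← Ideal.isCoprime_iff_sup_eq.1 h]
    exact sup_le_sup (discriminantIdeal_le_span b hb' d₁ hd₁)
      (discriminantIdeal_le_span c hc' d₂ hd₂)
  rw [Ideal.isCoprime_span_singleton_iff] at h3
  obtain ⟨u, v, huv⟩ := h3
  obtain ⟨z₁, hz₁⟩ := h1
  obtain ⟨z₂, hz₂⟩ := h2
  refine ⟨u * z₁ + v * z₂, ?_⟩
  rw [map_add, map_mul, map_mul, hz₁, hz₂, ← mul_assoc, ← mul_assoc, ← add_mul, ← map_mul,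
    ← map_mul, ← map_add, huv, map_one, one_mul]

end IntegralBases

/-! ### The product of two group algebras: Galois equivariance and action. -/

namespace GreitherPareigis

variable {K Kbar : Type*} [Field K] [Field Kbar] [Algebra K Kbar]

theorem evalCoset_mul {L : IntermediateField K Kbar} (c : Cosets L) (x y : L) :
    evalCoset c (x * y) = evalCoset c x * evalCoset c y := by
  induction c using QuotientGroup.induction_on with | _ g
  exact map_mul g ⟨x, L.le_normalClosure x.2⟩ ⟨y, L.le_normalClosure y.2⟩

/-- The action `(∑ hᵢ ηᵢ) · α = ∑ hᵢ ηᵢ⁻¹(1 G')(α)` of `L̃[N]` on `L`, with values in the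
algebraic closure. -/
noncomputable def groupAlgebraAct {L : IntermediateField K Kbar} {N : RegularSubgroup L} (α : L) :
    N.GroupAlgebra →+ Kbar :=
  (Finsupp.liftAddHom fun η : N.carrier => (AddMonoidHom.mulRight
    (evalCoset ((η : Equiv.Perm (Cosets L))⁻¹ ((1 : Gal(nc L/K)) : Cosets L)) α : Kbar)).comp
      (algebraMap (nc L) Kbar).toAddMonoidHom).comp
    MonoidAlgebra.coeffAddEquiv.toAddMonoidHom

theorem groupAlgebraAct_single {L : IntermediateField K Kbar} {N : RegularSubgroup L} (α : L)
    (η : N.carrier) (c : nc L) : groupAlgebraAct α (MonoidAlgebra.single η c) = (c : Kbar) *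
      evalCoset ((η : Equiv.Perm (Cosets L))⁻¹ ((1 : Gal(nc L/K)) : Cosets L)) α := by
  change Finsupp.liftAddHom _ (Finsupp.single η c) = _
  rw [Finsupp.liftAddHom_apply_single]
  rfl

theorem GivenBy.act_eq_groupAlgebraAct {L : IntermediateField K Kbar} {H : Type*} [Ring H]
    [HopfAlgebra K H] {S : HopfGaloisStructure K L H} {N : RegularSubgroup L} (P : GivenBy S N)
    (h : H) (α : L) : (S.act h α : Kbar) = groupAlgebraAct α (P.φ h) :=
  P.act_eq h α

theorem RegularSubgroup.galAct_single {L : IntermediateField K Kbar} (N : RegularSubgroup L)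
    (g : Gal(nc L/K)) (η : N.carrier) (c : nc L) :
    N.galAct g (MonoidAlgebra.single η c) = MonoidAlgebra.single (N.conj g η) (g c) := by
  change MonoidAlgebra.mapAlgHom _ _ (MonoidAlgebra.mapDomain _ _) = _
  rw [MonoidAlgebra.mapDomain_single, MonoidAlgebra.mapAlgHom_single]
  rfl

section Product

variable [IsAlgClosure K Kbar] {L₁ L₂ : IntermediateField K Kbar}
  [FiniteDimensional K L₁] [FiniteDimensional K L₂]
  [Algebra.IsSeparable K L₁] [Algebra.IsSeparable K L₂]
  (N₁ : RegularSubgroup L₁) (N₂ : RegularSubgroup L₂) (h : L₁.LinearDisjoint L₂)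

theorem coe_evalCoset_restrictCoset {E L : IntermediateField K Kbar} (hEL : E ≤ L) (c : Cosets L)
    (x : E) : (evalCoset (restrictCoset hEL c) x : Kbar) =
      evalCoset c (IntermediateField.inclusion hEL x) := by
  induction c using QuotientGroup.induction_on with | _ g
  rw [restrictCoset_mk]
  exact coe_restrictHom _ g ⟨x, E.le_normalClosure x.2⟩

theorem apply_inclusion {E F : IntermediateField K Kbar} [Normal K E] (hEF : E ≤ F)
    (g : Gal(F/K)) (x : E) : g (IntermediateField.inclusion hEF x) =
      IntermediateField.inclusion hEF (restrictHom hEF g x) :=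
  Subtype.ext (coe_restrictHom hEF g x).symm

/-- The homomorphism `N₁ × N₂ → ι(N₁ × N₂)`. -/
noncomputable def RegularSubgroup.iotaHom : N₁.carrier × N₂.carrier →* (N₁.prod N₂ h).carrier where
  toFun p := N₁.iotaMk N₂ h p.1 p.2
  map_one' := Subtype.ext (map_one (iota h))
  map_mul' p q := Subtype.ext (map_mul (iota h) (p.1.1, p.2.1) (q.1.1, q.2.1))

theorem RegularSubgroup.iotaHom_apply (η₁ : N₁.carrier) (η₂ : N₂.carrier) :
    N₁.iotaHom N₂ h (η₁, η₂) = N₁.iotaMk N₂ h η₁ η₂ := rfl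

theorem RegularSubgroup.conj_iotaMk (g : Gal(nc (L₁ ⊔ L₂)/K)) (η₁ : N₁.carrier)
    (η₂ : N₂.carrier) : (N₁.prod N₂ h).conj g (N₁.iotaMk N₂ h η₁ η₂) = N₁.iotaMk N₂ h
      (N₁.conj (restrictHom (IntermediateField.normalClosure_mono _ _ le_sup_left) g) η₁)
      (N₂.conj (restrictHom (IntermediateField.normalClosure_mono _ _ le_sup_right) g) η₂) := by
  apply Subtype.ext
  change leftTranslation (L₁ ⊔ L₂) g * iota h (η₁, η₂) * (leftTranslation (L₁ ⊔ L₂) g)⁻¹ = _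
  rw [leftTranslation_eq_iota h, ← map_mul, ← map_inv, ← map_mul]
  rfl

/-- The coset `η⁻¹(1 G')` governs the action on the field. It splits because `ι` acts componentwise
through `ψ`, and `ψ` sends the trivial coset to the pair of trivial cosets. -/
theorem psiEquiv_iotaMk_inv_one (η₁ : N₁.carrier) (η₂ : N₂.carrier) :
    psiEquiv h (((N₁.iotaMk N₂ h η₁ η₂ : (N₁.prod N₂ h).carrier) : Equiv.Perm _)⁻¹
      ((1 : Gal(nc (L₁ ⊔ L₂)/K)) : Cosets (L₁ ⊔ L₂))) =
      ((η₁ : Equiv.Perm (Cosets L₁))⁻¹ ((1 : Gal(nc L₁/K)) : Cosets L₁),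
        (η₂ : Equiv.Perm (Cosets L₂))⁻¹ ((1 : Gal(nc L₂/K)) : Cosets L₂)) := by
  change psiEquiv h ((iota h (η₁, η₂))⁻¹ _) = _
  rw [← map_inv, psiEquiv_iota]
  have h1 : psiEquiv h ((1 : Gal(nc (L₁ ⊔ L₂)/K)) : Cosets (L₁ ⊔ L₂)) =
      (((1 : Gal(nc L₁/K)) : Cosets L₁), ((1 : Gal(nc L₂/K)) : Cosets L₂)) := by
    change (restrictCoset le_sup_left _, restrictCoset le_sup_right _) = _
    rw [restrictCoset_mk, restrictCoset_mk, map_one, map_one]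
  rw [h1]
  rfl

/-- The map `L̃₁[N₁] → L̃[ι(N₁ × N₂)]`. -/
noncomputable def groupAlgebraInl : N₁.GroupAlgebra →ₐ[K] (N₁.prod N₂ h).GroupAlgebra :=
  (MonoidAlgebra.mapAlgHom _ (IntermediateField.inclusion
    (IntermediateField.normalClosure_mono L₁ (L₁ ⊔ L₂) le_sup_left))).comp
    (MonoidAlgebra.mapDomainAlgHom K (nc L₁) ((N₁.iotaHom N₂ h).comp (MonoidHom.inl _ _)))

/-- The map `L̃₂[N₂] → L̃[ι(N₁ × N₂)]`. -/
noncomputable def groupAlgebraInr : N₂.GroupAlgebra →ₐ[K] (N₁.prod N₂ h).GroupAlgebra :=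
  (MonoidAlgebra.mapAlgHom _ (IntermediateField.inclusion
    (IntermediateField.normalClosure_mono L₂ (L₁ ⊔ L₂) le_sup_right))).comp
    (MonoidAlgebra.mapDomainAlgHom K (nc L₂) ((N₁.iotaHom N₂ h).comp (MonoidHom.inr _ _)))

theorem groupAlgebraInl_single (η : N₁.carrier) (c : nc L₁) :
    groupAlgebraInl N₁ N₂ h (MonoidAlgebra.single η c) =
      MonoidAlgebra.single (N₁.iotaMk N₂ h η 1) (IntermediateField.inclusion
        (IntermediateField.normalClosure_mono L₁ (L₁ ⊔ L₂) le_sup_left) c) := by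
  change MonoidAlgebra.mapAlgHom _ _ (MonoidAlgebra.mapDomain _ _) = _
  rw [MonoidAlgebra.mapDomain_single, MonoidAlgebra.mapAlgHom_single]
  rfl

theorem groupAlgebraInr_single (η : N₂.carrier) (c : nc L₂) :
    groupAlgebraInr N₁ N₂ h (MonoidAlgebra.single η c) =
      MonoidAlgebra.single (N₁.iotaMk N₂ h 1 η) (IntermediateField.inclusion
        (IntermediateField.normalClosure_mono L₂ (L₁ ⊔ L₂) le_sup_right) c) := by
  change MonoidAlgebra.mapAlgHom _ _ (MonoidAlgebra.mapDomain _ _) = _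
  rw [MonoidAlgebra.mapDomain_single, MonoidAlgebra.mapAlgHom_single]
  rfl

theorem RegularSubgroup.iotaMk_mul_iotaMk (η₁ : N₁.carrier) (η₂ : N₂.carrier) :
    N₁.iotaMk N₂ h η₁ 1 * N₁.iotaMk N₂ h 1 η₂ = N₁.iotaMk N₂ h η₁ η₂ := by
  rw [← RegularSubgroup.iotaHom_apply, ← RegularSubgroup.iotaHom_apply, ← map_mul,
    Prod.mk_mul_mk, mul_one, one_mul, RegularSubgroup.iotaHom_apply]

/-- The two factors of `N₁ × N₂` commute, and the coefficients lie in a field. -/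
theorem groupAlgebraInl_commute_groupAlgebraInr (x : N₁.GroupAlgebra) (y : N₂.GroupAlgebra) :
    Commute (groupAlgebraInl N₁ N₂ h x) (groupAlgebraInr N₁ N₂ h y) := by
  induction x using MonoidAlgebra.induction_linear with
  | zero => rw [map_zero]; exact Commute.zero_left _
  | add x x' hx hx' => rw [map_add]; exact hx.add_left hx'
  | single η c =>
    induction y using MonoidAlgebra.induction_linear with
    | zero => rw [map_zero]; exact Commute.zero_right _
    | add y y' hy hy' => rw [map_add]; exact hy.add_right hy'
    | single η' c' =>
      rw [groupAlgebraInl_single, groupAlgebraInr_single]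
      refine MonoidAlgebra.single_commute_single ?_ (Commute.all _ _)
      exact Commute.map (MonoidHom.commute_inl_inr η η') (N₁.iotaHom N₂ h)

/-- Writing the double sum as a product of two algebra homomorphisms reduces multiplicativity and
Galois invariance to one factor at a time. -/
theorem groupAlgebraProd_eq_mul (x : N₁.GroupAlgebra) (y : N₂.GroupAlgebra) :
    groupAlgebraProd h x y = groupAlgebraInl N₁ N₂ h x * groupAlgebraInr N₁ N₂ h y := by
  conv_rhs => rw [← MonoidAlgebra.sum_coeff_single x, ← MonoidAlgebra.sum_coeff_single y]
  rw [map_finsuppSum, map_finsuppSum, Finsupp.sum_mul]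
  refine Finsupp.sum_congr fun η _ => ?_
  rw [Finsupp.mul_sum]
  refine Finsupp.sum_congr fun η' _ => ?_
  rw [groupAlgebraInl_single, groupAlgebraInr_single, MonoidAlgebra.single_mul_single,
    RegularSubgroup.iotaMk_mul_iotaMk]

theorem galAct_groupAlgebraInl (g : Gal(nc (L₁ ⊔ L₂)/K)) (x : N₁.GroupAlgebra) :
    (N₁.prod N₂ h).galAct g (groupAlgebraInl N₁ N₂ h x) = groupAlgebraInl N₁ N₂ h
      (N₁.galAct (restrictHom (IntermediateField.normalClosure_mono _ _ le_sup_left) g) x) := by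
  induction x using MonoidAlgebra.induction_linear with
  | zero => simp only [map_zero]
  | add x x' hx hx' => simp only [map_add, hx, hx']
  | single η c =>
    rw [groupAlgebraInl_single, RegularSubgroup.galAct_single, RegularSubgroup.galAct_single,
      groupAlgebraInl_single, RegularSubgroup.conj_iotaMk, map_one]
    rw [apply_inclusion]

theorem galAct_groupAlgebraInr (g : Gal(nc (L₁ ⊔ L₂)/K)) (x : N₂.GroupAlgebra) :
    (N₁.prod N₂ h).galAct g (groupAlgebraInr N₁ N₂ h x) = groupAlgebraInr N₁ N₂ h
      (N₂.galAct (restrictHom (IntermediateField.normalClosure_mono _ _ le_sup_right) g) x) := by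
  induction x using MonoidAlgebra.induction_linear with
  | zero => simp only [map_zero]
  | add x x' hx hx' => simp only [map_add, hx, hx']
  | single η c =>
    rw [groupAlgebraInr_single, RegularSubgroup.galAct_single, RegularSubgroup.galAct_single,
      groupAlgebraInr_single, RegularSubgroup.conj_iotaMk, map_one]
    rw [apply_inclusion]

-- Injectivity is linear disjointness; surjectivity follows from equality of dimensions.
omit [Algebra.IsSeparable K L₁] [Algebra.IsSeparable K L₂] [IsAlgClosure K Kbar] in
include h in
theorem productMap_inclusion_bijective : Function.Bijective (Algebra.TensorProduct.productMap
    (IntermediateField.inclusion (le_sup_left : L₁ ≤ L₁ ⊔ L₂))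
    (IntermediateField.inclusion (le_sup_right : L₂ ≤ L₁ ⊔ L₂))) := by
  have : FiniteDimensional K ↥(L₁ ⊔ L₂) := IntermediateField.finiteDimensional_sup L₁ L₂
  have hinj : Function.Injective (Algebra.TensorProduct.productMap
      (IntermediateField.inclusion (le_sup_left : L₁ ≤ L₁ ⊔ L₂))
      (IntermediateField.inclusion (le_sup_right : L₂ ≤ L₁ ⊔ L₂))) := by
    intro x y hxy
    apply (IntermediateField.linearDisjoint_iff'.1 h).injective
    have key : ∀ z : L₁ ⊗[K] L₂, Submodule.mulMap (Subalgebra.toSubmodule L₁.toSubalgebra)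
        (Subalgebra.toSubmodule L₂.toSubalgebra) z = (Algebra.TensorProduct.productMap
          (IntermediateField.inclusion (le_sup_left : L₁ ≤ L₁ ⊔ L₂))
          (IntermediateField.inclusion (le_sup_right : L₂ ≤ L₁ ⊔ L₂)) z : Kbar) := by
      intro z
      induction z with
      | zero => rw [map_zero, map_zero]; rfl
      | add x y hx hy => rw [map_add, map_add, hx, hy]; rfl
      | tmul x y => rfl
    exact (key x).trans ((congrArg _ hxy).trans (key y).symm)
  refine ⟨hinj, ?_⟩
  refine (LinearMap.injective_iff_surjective_of_finrank_eq_finrank 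
    (f := (Algebra.TensorProduct.productMap (IntermediateField.inclusion
      (le_sup_left : L₁ ≤ L₁ ⊔ L₂)) (IntermediateField.inclusion
      (le_sup_right : L₂ ≤ L₁ ⊔ L₂))).toLinearMap) ?_).1 hinj
  rw [Module.finrank_tensorProduct, h.finrank_sup]

/-- Multiplication as an isomorphism `L₁ ⊗ L₂ ≃ L₁ L₂`, for linearly disjoint `L₁`, `L₂`. -/
noncomputable def tensorEquivSup : L₁ ⊗[K] L₂ ≃ₐ[K] ↥(L₁ ⊔ L₂) :=
  AlgEquiv.ofBijective _ (productMap_inclusion_bijective h)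

omit [Algebra.IsSeparable K L₁] [Algebra.IsSeparable K L₂] [IsAlgClosure K Kbar] in
theorem tensorEquivSup_tmul (x : L₁) (y : L₂) : tensorEquivSup h (x ⊗ₜ y) =
    IntermediateField.inclusion le_sup_left x * IntermediateField.inclusion le_sup_right y :=
  Algebra.TensorProduct.productMap_apply_tmul ..

/-- By additivity only single terms matter. There the coset splits under `ψ`, and evaluation at a
coset is multiplicative and compatible with restriction. -/
theorem groupAlgebraAct_groupAlgebraProd (x : N₁.GroupAlgebra) (y : N₂.GroupAlgebra) (α : L₁)
    (β : L₂) : groupAlgebraAct (tensorEquivSup h (α ⊗ₜ β)) (groupAlgebraProd h x y) =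
      groupAlgebraAct α x * groupAlgebraAct β y := by
  rw [groupAlgebraProd_eq_mul]
  induction x using MonoidAlgebra.induction_linear with
  | zero => simp only [map_zero, zero_mul]
  | add x x' hx hx' => simp only [map_add, hx, hx', add_mul]
  | single η c =>
    induction y using MonoidAlgebra.induction_linear with
    | zero => simp only [map_zero, mul_zero]
    | add y y' hy hy' => simp only [map_add, hy, hy', mul_add]
    | single η' c' =>
      rw [groupAlgebraInl_single, groupAlgebraInr_single, MonoidAlgebra.single_mul_single,
        RegularSubgroup.iotaMk_mul_iotaMk, groupAlgebraAct_single, groupAlgebraAct_single,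
        groupAlgebraAct_single]
      have h1 := psiEquiv_iotaMk_inv_one N₁ N₂ h η η'
      have h2 : restrictCoset le_sup_left _ = _ := congrArg Prod.fst h1
      have h3 : restrictCoset le_sup_right _ = _ := congrArg Prod.snd h1
      dsimp only at h2 h3
      rw [← h2, ← h3, coe_evalCoset_restrictCoset, coe_evalCoset_restrictCoset, mul_mul_mul_comm,
        tensorEquivSup_tmul, evalCoset_mul, IntermediateField.coe_mul, IntermediateField.coe_mul,
        IntermediateField.coe_inclusion, IntermediateField.coe_inclusion]

end Product

end GreitherPareigis

theorem Module.Basis.isIntegral_of_repr_mem_range {O K L ι : Type*} [CommRing O] [Field K]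
    [Algebra O K] [Field L] [Algebra K L] [Algebra O L] [IsScalarTower O K L] [Fintype ι]
    (b : Module.Basis ι K L) (hb : ∀ i, IsIntegral O (b i)) (y : L)
    (hy : ∀ i, b.repr y i ∈ Set.range (algebraMap O K)) : IsIntegral O y := by
  rw [← b.sum_repr y]
  refine IsIntegral.sum _ fun j _ => ?_
  obtain ⟨r, hr⟩ := hy j
  rw [← hr, algebraMap_smul]
  exact (hb j).smul r

/-! ### Faithfulness, dimension and associated orders of Hopf-Galois structures. -/

namespace HopfGaloisStructure

section Basic

variable {K L H : Type*} [Field K] [Field L] [Algebra K L] [Ring H] [HopfAlgebra K H]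
  (S : HopfGaloisStructure K L H)

/-- The action is the restriction to `1 ⊗ H` of the bijection `L ⊗ H → End_K(L)`. -/
theorem act_injective : Function.Injective S.act := by
  rw [injective_iff_map_eq_zero]
  intro h hh
  have h1 : (1 : L) ⊗ₜ[K] h = 0 := by
    apply S.bijective.injective
    rw [map_zero, TensorProduct.lift.tmul]
    change Algebra.lmul K L 1 * S.act h = 0
    rw [hh, mul_zero]
  exact Algebra.TensorProduct.includeRight_injective (algebraMap K L).injective
    (h1.trans (TensorProduct.tmul_zero _ _).symm)

-- The same bijection gives `[L : K] * dim H = [L : K] ^ 2`.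
include S in
theorem finrank_eq [FiniteDimensional K L] : Module.finrank K H = Module.finrank K L := by
  have h1 := (LinearEquiv.ofBijective _ S.bijective).finrank_eq
  rw [Module.finrank_tensorProduct, Module.finrank_linearMap] at h1
  exact Nat.eq_of_mul_eq_mul_left Module.finrank_pos h1

variable {O : Type*} [CommRing O] [Algebra O K] [Algebra O L] [IsScalarTower O K L] [Algebra O H]
  [IsScalarTower O K H]

theorem mem_associatedOrder {h : H} :
    h ∈ S.associatedOrder O ↔ ∀ α, IsIntegral O α → IsIntegral O (S.act h α) := Iff.rfl

theorem coe_associatedOrder_smul (a : S.associatedOrder O) (x : integralClosure O L) :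
    ((a • x : integralClosure O L) : L) = S.act a x := rfl

instance : IsScalarTower O (S.associatedOrder O) (integralClosure O L) where
  smul_assoc r a x := by
    apply Subtype.ext
    change S.act (r • (a : H)) x = r • S.act a x
    rw [← algebraMap_smul K r (a : H), map_smul, LinearMap.smul_apply, algebraMap_smul]

theorem mem_associatedOrder_of_basis {ι : Type*} [Fintype ι] (b : Module.Basis ι K L)
    (hb' : ∀ y, IsIntegral O y → ∀ i, b.repr y i ∈ Set.range (algebraMap O K)) (h : H)
    (hh : ∀ i, IsIntegral O (S.act h (b i))) : h ∈ S.associatedOrder O := by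
  rw [mem_associatedOrder]
  intro α hα
  rw [← b.sum_repr α, map_sum]
  refine IsIntegral.sum _ fun i _ => ?_
  obtain ⟨r, hr⟩ := hb' α hα i
  rw [map_smul, ← hr, algebraMap_smul]
  exact (hh i).smul r

end Basic

/-! ### Associated orders and rings of integers under a tensor product of actions. -/

section Product

variable {O K L₁ L₂ L H₁ H₂ H : Type*} [CommRing O] [IsDomain O] [IsPrincipalIdealRing O]
  [Field K] [Algebra O K] [IsFractionRing O K] [Field L₁] [Field L₂] [Field L]
  [Algebra K L₁] [Algebra K L₂] [Algebra K L] [Algebra O L₁] [Algebra O L₂] [Algebra O L]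
  [IsScalarTower O K L₁] [IsScalarTower O K L₂] [IsScalarTower O K L]
  [Ring H₁] [HopfAlgebra K H₁] [Algebra O H₁] [IsScalarTower O K H₁]
  [Ring H₂] [HopfAlgebra K H₂] [Algebra O H₂] [IsScalarTower O K H₂]
  [Ring H] [HopfAlgebra K H] [Algebra O H] [IsScalarTower O K H]
  (S₁ : HopfGaloisStructure K L₁ H₁) (S₂ : HopfGaloisStructure K L₂ H₂)
  (S : HopfGaloisStructure K L H)
  (e : L₁ ⊗[K] L₂ ≃ₐ[K] L) (f : H₁ ⊗[K] H₂ ≃ₐ[K] H)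

/-- The map `a₁ ⊗ a₂ ↦ f (a₁ ⊗ a₂)` on the tensor product of the associated orders. -/
noncomputable def orderTensorHom : S₁.associatedOrder O ⊗[O] S₂.associatedOrder O →ₐ[O] H :=
  Algebra.TensorProduct.lift
    (((f.toAlgHom.comp Algebra.TensorProduct.includeLeft).restrictScalars O).comp
      (S₁.associatedOrder O).val)
    (((f.toAlgHom.comp Algebra.TensorProduct.includeRight).restrictScalars O).comp
      (S₂.associatedOrder O).val)
    fun a b => Commute.map (f := f) (by
      change _ * _ = _ * _
      simp)

omit [IsDomain O] [IsPrincipalIdealRing O] [IsFractionRing O K] in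
theorem orderTensorHom_tmul (a₁ : S₁.associatedOrder O) (a₂ : S₂.associatedOrder O) :
    orderTensorHom S₁ S₂ f (a₁ ⊗ₜ a₂) = f ((a₁ : H₁) ⊗ₜ[K] (a₂ : H₂)) := by
  refine (Algebra.TensorProduct.lift_tmul ..).trans ?_
  change f _ * f _ = _
  rw [← map_mul]
  simp

omit [IsDomain O] [IsPrincipalIdealRing O] [IsFractionRing O K] in
theorem orderTensorHom_eq (t : S₁.associatedOrder O ⊗[O] S₂.associatedOrder O) :
    orderTensorHom S₁ S₂ f t = f ((Subalgebra.toSubmodule (S₁.associatedOrder O)).tensorToTensor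
      (Subalgebra.toSubmodule (S₂.associatedOrder O)) t) := by
  induction t with
  | zero => rw [map_zero]; exact ((congrArg f (map_zero _)).trans (map_zero f)).symm
  | add x y hx hy =>
    rw [map_add, hx, hy, ← map_add]
    exact congrArg f (map_add _ _ _).symm
  | tmul a₁ a₂ => exact orderTensorHom_tmul S₁ S₂ f a₁ a₂

theorem orderTensorHom_injective : Function.Injective (orderTensorHom (O := O) S₁ S₂ f) := by
  intro x y hxy
  rw [orderTensorHom_eq, orderTensorHom_eq] at hxy
  exact Submodule.tensorToTensor_injective K _ _ (f.injective hxy)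

variable (hef : ∀ t x, S.act (f t) (e x) = e (TensorProduct.homTensorHomMap (RingHom.id K)
    L₁ L₂ L₁ L₂ (TensorProduct.map S₁.act.toLinearMap S₂.act.toLinearMap t) x))

include hef in
theorem act_tmul (h₁ : H₁) (h₂ : H₂) (x : L₁) (y : L₂) : S.act (f (h₁ ⊗ₜ h₂)) (e (x ⊗ₜ y)) =
    e (S₁.act h₁ x ⊗ₜ S₂.act h₂ y) := by
  rw [hef, TensorProduct.map_tmul, TensorProduct.homTensorHomMap_apply, TensorProduct.map_tmul]
  rfl

omit [IsDomain O] [IsPrincipalIdealRing O] [IsFractionRing O K] in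
theorem isIntegral_tmul {x : L₁} {y : L₂} (hx : IsIntegral O x) (hy : IsIntegral O y) :
    IsIntegral O (e (x ⊗ₜ y)) := by
  have h1 : e (x ⊗ₜ y) = (e.toAlgHom.comp Algebra.TensorProduct.includeLeft) x *
      (e.toAlgHom.comp Algebra.TensorProduct.includeRight) y := by
    change _ = e (x ⊗ₜ 1) * e (1 ⊗ₜ y)
    rw [← map_mul, Algebra.TensorProduct.tmul_mul_tmul, one_mul, mul_one]
  rw [h1]
  exact (hx.map ((e.toAlgHom.comp Algebra.TensorProduct.includeLeft).restrictScalars O)).mul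
    (hy.map ((e.toAlgHom.comp Algebra.TensorProduct.includeRight).restrictScalars O))

variable {n₁ n₂ : Type*} [Fintype n₁] [Fintype n₂]
  (b : Module.Basis n₁ K L₁) (hb : ∀ i, IsIntegral O (b i))
  (hb' : ∀ y, IsIntegral O y → ∀ k, b.repr y k ∈ Set.range (algebraMap O K))
  (c : Module.Basis n₂ K L₂) (hc : ∀ i, IsIntegral O (c i))
  (hc' : ∀ y, IsIntegral O y → ∀ k, c.repr y k ∈ Set.range (algebraMap O K))
  (hbc : ∀ x, IsIntegral O (e x) → ∀ p, (b.tensorProduct c).repr x p ∈ Set.range (algebraMap O K))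

-- The products `e (b i ⊗ c j)` are an integral basis of `L` by `hbc`, and a pure tensor of order
-- elements maps each of them to a product of integral elements.
omit [IsDomain O] [IsPrincipalIdealRing O] [IsFractionRing O K] in
include b hb c hc hbc hef in
theorem orderTensorHom_mem (t : S₁.associatedOrder O ⊗[O] S₂.associatedOrder O) :
    orderTensorHom S₁ S₂ f t ∈ S.associatedOrder O := by
  induction t with
  | zero => rw [map_zero]; exact zero_mem _
  | add x y hx hy => rw [map_add]; exact add_mem hx hy
  | tmul a₁ a₂ =>
    refine S.mem_associatedOrder_of_basis ((b.tensorProduct c).map e.toLinearEquiv) ?_ _ ?_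
    · intro y hy p
      exact hbc _ (by
        change IsIntegral O (e (e.symm y))
        rwa [AlgEquiv.apply_symm_apply]) p
    · rintro ⟨i, j⟩
      rw [orderTensorHom_tmul, Module.Basis.map_apply, Module.Basis.tensorProduct_apply]
      change IsIntegral O (S.act _ (e _))
      rw [act_tmul S₁ S₂ S e f hef]
      exact isIntegral_tmul e (a₁.2 _ (hb i)) (a₂.2 _ (hc j))

include b hb hb' c hc hc' hbc hef in
theorem mem_range_orderTensorHom {h : H} (hh : h ∈ S.associatedOrder O) :
    h ∈ (orderTensorHom (O := O) S₁ S₂ f).range := by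
  obtain ⟨t, ht⟩ := Submodule.mem_range_tensorToTensor_of_preserving b c
    S₁.act.toLinearMap S₁.act_injective S₂.act.toLinearMap S₂.act_injective
    (Subalgebra.toSubmodule (S₁.associatedOrder O))
    (fun h hh => S₁.mem_associatedOrder_of_basis b hb' h fun i => b.isIntegral_of_repr_mem_range hb _ (hh i))
    (Subalgebra.toSubmodule (S₂.associatedOrder O))
    (fun h hh => S₂.mem_associatedOrder_of_basis c hc' h fun i => c.isIntegral_of_repr_mem_range hc _ (hh i))
    -- As `h` preserves `𝒪_L`, it sends each `e (b i ⊗ c j)` to an integral element, whose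
    -- coordinates lie in `O` by `hbc`.
    (f.symm h) (by
      rintro ⟨i, j⟩ p
      apply hbc
      rw [← hef, AlgEquiv.apply_symm_apply]
      apply hh
      rw [Module.Basis.tensorProduct_apply]
      exact isIntegral_tmul e (hb i) (hc j))
  refine ⟨t, ?_⟩
  exact (orderTensorHom_eq S₁ S₂ f t).trans ((congrArg f ht).trans (f.apply_symm_apply h))

/-- The isomorphism between the tensor product of the associated orders and the associated order of
the product structure. -/
noncomputable def orderTensorEquiv :
    S₁.associatedOrder O ⊗[O] S₂.associatedOrder O ≃ₐ[O] S.associatedOrder O :=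
  AlgEquiv.ofBijective ((orderTensorHom S₁ S₂ f).codRestrict (S.associatedOrder O)
    (orderTensorHom_mem S₁ S₂ S e f hef b hb c hc hbc))
    ⟨fun _ _ hxy => orderTensorHom_injective S₁ S₂ f (congrArg Subtype.val hxy), fun h => by
      obtain ⟨t, ht⟩ := mem_range_orderTensorHom S₁ S₂ S e f hef b hb hb' c hc hc' hbc h.2
      exact ⟨t, Subtype.ext ht⟩⟩

theorem coe_orderTensorEquiv_tmul (a₁ : S₁.associatedOrder O) (a₂ : S₂.associatedOrder O) :
    (orderTensorEquiv S₁ S₂ S e f hef b hb hb' c hc hc' hbc (a₁ ⊗ₜ a₂) : H) =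
      f ((a₁ : H₁) ⊗ₜ[K] (a₂ : H₂)) :=
  orderTensorHom_tmul S₁ S₂ f a₁ a₂

/-- Multiplication `𝒪_{L₁} ⊗ 𝒪_{L₂} → 𝒪_L`. -/
noncomputable def integersTensorHom :
    integralClosure O L₁ ⊗[O] integralClosure O L₂ →ₗ[O] integralClosure O L :=
  TensorProduct.lift <| LinearMap.mk₂ O
    (fun x y => ⟨e ((x : L₁) ⊗ₜ (y : L₂)), isIntegral_tmul e x.2 y.2⟩)
    (fun x x' y => Subtype.ext (by simp [TensorProduct.add_tmul]))
    (fun r x y => Subtype.ext (by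
      change e ((r • (x : L₁)) ⊗ₜ (y : L₂)) = r • e ((x : L₁) ⊗ₜ (y : L₂))
      rw [← algebraMap_smul K r (x : L₁), ← TensorProduct.smul_tmul', map_smul, algebraMap_smul]))
    (fun x y y' => Subtype.ext (by simp [TensorProduct.tmul_add]))
    (fun r x y => Subtype.ext (by
      change e ((x : L₁) ⊗ₜ (r • (y : L₂))) = r • e ((x : L₁) ⊗ₜ (y : L₂))
      rw [← algebraMap_smul K r (y : L₂), TensorProduct.tmul_smul, map_smul, algebraMap_smul]))

omit [IsDomain O] [IsPrincipalIdealRing O] [IsFractionRing O K] in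
theorem coe_integersTensorHom_tmul (x : integralClosure O L₁) (y : integralClosure O L₂) :
    (integersTensorHom e (x ⊗ₜ y) : L) = e ((x : L₁) ⊗ₜ (y : L₂)) := rfl

omit [IsDomain O] [IsPrincipalIdealRing O] [IsFractionRing O K] in
theorem coe_integersTensorHom (t : integralClosure O L₁ ⊗[O] integralClosure O L₂) :
    (integersTensorHom e t : L) =
      e ((Subalgebra.toSubmodule (integralClosure O L₁)).tensorToTensor
        (Subalgebra.toSubmodule (integralClosure O L₂)) t) := by
  induction t with
  | zero => rw [map_zero]; exact ((congrArg e (map_zero _)).trans (map_zero e)).symm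
  | add x y hx hy =>
    rw [map_add, Subalgebra.coe_add, hx, hy, ← map_add]
    exact congrArg e (map_add _ _ _).symm
  | tmul a₁ a₂ => rfl

-- Injectivity is the embedding of lattices into the tensor product over `K`; surjectivity is `hbc`,
-- the absence of denominators in the product basis.
include b hb c hc hbc in
theorem integersTensorHom_bijective : Function.Bijective (integersTensorHom (O := O) e) := by
  constructor
  · intro x y hxy
    have h1 := congrArg Subtype.val hxy
    rw [coe_integersTensorHom, coe_integersTensorHom] at h1
    exact Submodule.tensorToTensor_injective K _ _ (e.injective h1)
  · intro y
    rw [← LinearMap.mem_range]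
    choose r hr using hbc (e.symm y) (by rw [AlgEquiv.apply_symm_apply]; exact y.2)
    have h1 : y = ∑ p : n₁ × n₂, r p • integersTensorHom e
        ((⟨b p.1, hb p.1⟩ : integralClosure O L₁) ⊗ₜ (⟨c p.2, hc p.2⟩ : integralClosure O L₂)) := by
      apply Subtype.ext
      have h2 : (y : L) = e (e.symm y) := (e.apply_symm_apply _).symm
      rw [h2, ← (b.tensorProduct c).sum_repr (e.symm y), map_sum, AddSubmonoidClass.coe_finsetSum]
      refine Finset.sum_congr rfl fun p _ => ?_
      rw [map_smul, ← hr, algebraMap_smul, Module.Basis.tensorProduct_apply']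
      rfl
    rw [h1]
    exact Submodule.sum_mem _ fun p _ => Submodule.smul_mem _ _ ⟨_, rfl⟩

-- The products `v` of basis elements form a basis: the coordinate map `𝔄_H^(I × J) → 𝒪_L` is, up to
-- isomorphism, the tensor product over `O` of the coordinate isomorphisms of the factors.
include e f hef b hb hb' c hc hc' hbc in
theorem free_integralClosure_of_free
    [Module.Free (S₁.associatedOrder O) (integralClosure O L₁)]
    [Module.Free (S₂.associatedOrder O) (integralClosure O L₂)] :
    Module.Free (S.associatedOrder O) (integralClosure O L) := by
  let β := Module.Free.chooseBasis (S₁.associatedOrder O) (integralClosure O L₁)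
  let γ := Module.Free.chooseBasis (S₂.associatedOrder O) (integralClosure O L₂)
  let F := orderTensorEquiv S₁ S₂ S e f hef b hb hb' c hc hc' hbc
  have hF : ∀ (a₁ : S₁.associatedOrder O) (a₂ : S₂.associatedOrder O)
      (x : integralClosure O L₁) (y : integralClosure O L₂),
      F (a₁ ⊗ₜ a₂) • integersTensorHom e (x ⊗ₜ y) = integersTensorHom e ((a₁ • x) ⊗ₜ (a₂ • y)) := by
    intro a₁ a₂ x y
    apply Subtype.ext
    rw [coe_associatedOrder_smul, coe_orderTensorEquiv_tmul, coe_integersTensorHom_tmul,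
      act_tmul S₁ S₂ S e f hef, coe_integersTensorHom_tmul]
    rfl
  let v := fun p : _ × _ => integersTensorHom e (β p.1 ⊗ₜ γ p.2)
  let E₁ := finsuppTensorFinsupp O O (S₁.associatedOrder O) (S₂.associatedOrder O)
    (Module.Free.ChooseBasisIndex (S₁.associatedOrder O) (integralClosure O L₁))
    (Module.Free.ChooseBasisIndex (S₂.associatedOrder O) (integralClosure O L₂)) ≪≫ₗ
    Finsupp.mapRange.linearEquiv F.toLinearEquiv
  let E₂ := TensorProduct.congr (β.repr.symm.restrictScalars O) (γ.repr.symm.restrictScalars O)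
  -- A commutative square whose other three sides `E₁`, `E₂` and `integersTensorHom e` are
  -- bijective; it holds on pure tensors of single terms by `hF`.
  have key : ∀ z, Finsupp.linearCombination (S.associatedOrder O) v (E₁ z) =
      integersTensorHom e (E₂ z) := by
    intro z
    induction z with
    | zero => simp only [map_zero]
    | add x y hx hy => simp only [map_add, hx, hy]
    | tmul x y =>
      induction x using Finsupp.induction_linear with
      | zero => simp only [TensorProduct.zero_tmul, map_zero]
      | add x x' hx hx' => simp only [TensorProduct.add_tmul, map_add, hx, hx']
      | single i a₁ =>
        induction y using Finsupp.induction_linear with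
        | zero => simp only [TensorProduct.tmul_zero, map_zero]
        | add y y' hy hy' => simp only [TensorProduct.tmul_add, map_add, hy, hy']
        | single j a₂ =>
          have h1 : E₁ (Finsupp.single i a₁ ⊗ₜ Finsupp.single j a₂) =
              Finsupp.single (i, j) (F (a₁ ⊗ₜ a₂)) := by
            rw [LinearEquiv.trans_apply, finsuppTensorFinsupp_single]
            exact Finsupp.mapRange_single (hf := map_zero F)
          have h2 : E₂ (Finsupp.single i a₁ ⊗ₜ Finsupp.single j a₂) = (a₁ • β i) ⊗ₜ (a₂ • γ j) := by
            rw [TensorProduct.congr_tmul]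
            change β.repr.symm _ ⊗ₜ γ.repr.symm _ = _
            rw [Module.Basis.repr_symm_single, Module.Basis.repr_symm_single]
          rw [h1, h2, Finsupp.linearCombination_single, hF]
  have hbij : Function.Bijective (Finsupp.linearCombination (S.associatedOrder O) v) := by
    have h1 := (integersTensorHom_bijective e b hb c hc hbc).comp (E₂.bijective.comp
      E₁.symm.bijective)
    convert h1 using 1
    funext z
    rw [← E₁.apply_symm_apply z, key]
    simp
  exact Module.Free.of_equiv (LinearEquiv.ofBijective _ hbij)

end Product

end HopfGaloisStructure

/-! ### The isomorphism from `H₁ ⊗ H₂` to the product Hopf algebra. -/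

namespace GreitherPareigis

section Product

variable {K Kbar H₁ H₂ H : Type*} [Field K] [Field Kbar] [Algebra K Kbar] [IsAlgClosure K Kbar]
  {L₁ L₂ : IntermediateField K Kbar} [FiniteDimensional K L₁] [FiniteDimensional K L₂]
  [Algebra.IsSeparable K L₁] [Algebra.IsSeparable K L₂]
  [Ring H₁] [HopfAlgebra K H₁] [Ring H₂] [HopfAlgebra K H₂] [Ring H] [HopfAlgebra K H]
  {S₁ : HopfGaloisStructure K L₁ H₁} {S₂ : HopfGaloisStructure K L₂ H₂}
  {S : HopfGaloisStructure K ↥(L₁ ⊔ L₂) H} {N₁ : RegularSubgroup L₁} {N₂ : RegularSubgroup L₂}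
  (h : L₁.LinearDisjoint L₂) (P₁ : GivenBy S₁ N₁) (P₂ : GivenBy S₂ N₂)
  (P : GivenBy S (N₁.prod N₂ h))

/-- The map `H₁ ⊗ H₂ → L̃[ι(N₁ × N₂)]`. -/
noncomputable def tensorToGroupAlgebra : H₁ ⊗[K] H₂ →ₐ[K] (N₁.prod N₂ h).GroupAlgebra :=
  Algebra.TensorProduct.lift ((groupAlgebraInl N₁ N₂ h).comp P₁.φ)
    ((groupAlgebraInr N₁ N₂ h).comp P₂.φ)
    fun x y => groupAlgebraInl_commute_groupAlgebraInr N₁ N₂ h (P₁.φ x) (P₂.φ y)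

theorem tensorToGroupAlgebra_tmul (x : H₁) (y : H₂) :
    tensorToGroupAlgebra h P₁ P₂ (x ⊗ₜ y) = groupAlgebraProd h (P₁.φ x) (P₂.φ y) :=
  (Algebra.TensorProduct.lift_tmul ..).trans (groupAlgebraProd_eq_mul N₁ N₂ h _ _).symm

/-- An element `g` acts on the two factors through its restrictions to `L̃₁` and `L̃₂`, which fix
the images of `H₁` and `H₂`. -/
theorem tensorToGroupAlgebra_mem_fixedAlgebra (t : H₁ ⊗[K] H₂) :
    tensorToGroupAlgebra h P₁ P₂ t ∈ (N₁.prod N₂ h).fixedAlgebra := by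
  induction t with
  | zero => rw [map_zero]; exact zero_mem _
  | add x y hx hy => rw [map_add]; exact add_mem hx hy
  | tmul x y =>
    intro g
    have hx : P₁.φ x ∈ N₁.fixedAlgebra := P₁.range_eq ▸ ⟨x, rfl⟩
    have hy : P₂.φ y ∈ N₂.fixedAlgebra := P₂.range_eq ▸ ⟨y, rfl⟩
    rw [tensorToGroupAlgebra_tmul, groupAlgebraProd_eq_mul, map_mul, galAct_groupAlgebraInl,
      galAct_groupAlgebraInr, hx, hy]

/-- The homomorphism `H₁ ⊗ H₂ → H`. -/
noncomputable def tensorHom : H₁ ⊗[K] H₂ →ₐ[K] H :=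
  (AlgEquiv.ofInjective P.φ P.injective).symm.toAlgHom.comp
    ((tensorToGroupAlgebra h P₁ P₂).codRestrict P.φ.range fun t =>
      P.range_eq ▸ tensorToGroupAlgebra_mem_fixedAlgebra h P₁ P₂ t)

theorem φ_tensorHom (t : H₁ ⊗[K] H₂) :
    P.φ (tensorHom h P₁ P₂ P t) = tensorToGroupAlgebra h P₁ P₂ t :=
  congrArg Subtype.val ((AlgEquiv.ofInjective P.φ P.injective).apply_symm_apply
    ⟨tensorToGroupAlgebra h P₁ P₂ t, _⟩)

theorem act_tensorHom (t : H₁ ⊗[K] H₂) (x : L₁ ⊗[K] L₂) :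
    S.act (tensorHom h P₁ P₂ P t) (tensorEquivSup h x) =
      tensorEquivSup h (TensorProduct.homTensorHomMap (RingHom.id K) L₁ L₂ L₁ L₂
        (TensorProduct.map S₁.act.toLinearMap S₂.act.toLinearMap t) x) := by
  induction t with
  | zero => simp only [map_zero, LinearMap.zero_apply]
  | add t t' ht ht' => simp only [map_add, LinearMap.add_apply, ht, ht']
  | tmul a b =>
    induction x with
    | zero => simp only [map_zero]
    | add x x' hx hx' => simp only [map_add, hx, hx']
    | tmul α β =>
      apply Subtype.ext
      rw [P.act_eq_groupAlgebraAct, φ_tensorHom, tensorToGroupAlgebra_tmul,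
        groupAlgebraAct_groupAlgebraProd, ← P₁.act_eq_groupAlgebraAct,
        ← P₂.act_eq_groupAlgebraAct, TensorProduct.map_tmul, TensorProduct.homTensorHomMap_apply,
        TensorProduct.map_tmul, tensorEquivSup_tmul, IntermediateField.coe_mul,
        IntermediateField.coe_inclusion, IntermediateField.coe_inclusion]
      rfl

/-- An element of the kernel acts as zero on `L₁ ⊗ L₂`, hence vanishes since `H₁ ⊗ H₂` acts
faithfully there. Both sides have dimension `[L₁ : K] * [L₂ : K]`. -/
theorem tensorHom_bijective : Function.Bijective (tensorHom h P₁ P₂ P) := by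
  have := S₁.finite
  have := S₂.finite
  have := S.finite
  have : FiniteDimensional K ↥(L₁ ⊔ L₂) := IntermediateField.finiteDimensional_sup L₁ L₂
  have hinj : Function.Injective (tensorHom h P₁ P₂ P) := by
    rw [injective_iff_map_eq_zero]
    intro t ht
    have h1 : TensorProduct.homTensorHomMap (RingHom.id K) L₁ L₂ L₁ L₂
        (TensorProduct.map S₁.act.toLinearMap S₂.act.toLinearMap t) = 0 := by
      ext1
      refine LinearMap.ext fun x => LinearMap.ext fun y => ?_
      apply (tensorEquivSup h).injective
      have h2 := act_tensorHom h P₁ P₂ P t (x ⊗ₜ y)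
      rw [ht, map_zero, LinearMap.zero_apply] at h2
      exact h2.symm.trans (map_zero (tensorEquivSup h)).symm
    -- Over a field a tensor product of injective maps is injective, and by finite dimension
    -- `End(L₁) ⊗ End(L₂)` is all of `End(L₁ ⊗ L₂)`.
    apply TensorProduct.map_injective_of_flat_flat S₁.act.toLinearMap S₂.act.toLinearMap
      S₁.act_injective S₂.act_injective
    apply (homTensorHomEquiv K L₁ L₂ L₁ L₂).injective
    rw [map_zero, map_zero, ← h1]
    exact homTensorHomEquiv_apply ..
  refine ⟨hinj, ?_⟩
  refine (LinearMap.injective_iff_surjective_of_finrank_eq_finrank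
    (f := (tensorHom h P₁ P₂ P).toLinearMap) ?_).1 hinj
  rw [Module.finrank_tensorProduct, S₁.finrank_eq, S₂.finrank_eq, S.finrank_eq, h.finrank_sup]

end Product

end GreitherPareigis

theorem mainTheorem8 {O K Kbar H₁ H₂ H : Type*}
    [CommRing O] [IsDomain O] [IsPrincipalIdealRing O]
    [Field K] [Algebra O K] [IsFractionRing O K]
    [Field Kbar] [Algebra K Kbar] [IsAlgClosure K Kbar]
    [Algebra O Kbar] [IsScalarTower O K Kbar]
    -- the extensions `L₁/K`, `L₂/K` with Galois complements `M₁`, `M₂`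
    (L₁ L₂ M₁ M₂ : IntermediateField K Kbar)
    [FiniteDimensional K L₁] [FiniteDimensional K L₂]
    [Algebra.IsSeparable K L₁] [Algebra.IsSeparable K L₂]
    (hM₁ : IsGaloisComplement L₁ M₁) (hM₂ : IsGaloisComplement L₂ M₂)
    (hstrong : StronglyDisjoint L₁ M₁ L₂ M₂)
    (harith : ArithmeticallyDisjoint O L₁ L₂)
    -- Hopf-Galois structures on `L₁/K`, `L₂/K` and on the compositum `L₁L₂/K`
    [Ring H₁] [HopfAlgebra K H₁] [Algebra O H₁] [IsScalarTower O K H₁]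
    [Ring H₂] [HopfAlgebra K H₂] [Algebra O H₂] [IsScalarTower O K H₂]
    [Ring H] [HopfAlgebra K H] [Algebra O H] [IsScalarTower O K H]
    (S₁ : HopfGaloisStructure K L₁ H₁) (S₂ : HopfGaloisStructure K L₂ H₂)
    (S : HopfGaloisStructure K ↥(L₁ ⊔ L₂) H)
    -- `S` is the product Hopf-Galois structure of `S₁` and `S₂`
    (N₁ : GreitherPareigis.RegularSubgroup L₁) (N₂ : GreitherPareigis.RegularSubgroup L₂)
    (P₁ : GreitherPareigis.GivenBy S₁ N₁) (P₂ : GreitherPareigis.GivenBy S₂ N₂)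
    (P : GreitherPareigis.GivenBy S (N₁.prod N₂ hstrong.linearDisjoint)) :
    -- the canonical isomorphism `f : H₁ ⊗ H₂ → H` restricts to `𝔄_{H₁} ⊗ 𝔄_{H₂} ≃ 𝔄_H`
    (∃ f : H₁ ⊗[K] H₂ ≃ₐ[K] H,
      (∀ (h₁ : H₁) (h₂ : H₂), P.φ (f (h₁ ⊗ₜ[K] h₂)) =
        GreitherPareigis.groupAlgebraProd hstrong.linearDisjoint (P₁.φ h₁) (P₂.φ h₂)) ∧
      ∃ F : (S₁.associatedOrder O) ⊗[O] (S₂.associatedOrder O) ≃ₐ[O] S.associatedOrder O,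
        ∀ (a₁ : S₁.associatedOrder O) (a₂ : S₂.associatedOrder O),
          (F (a₁ ⊗ₜ[O] a₂) : H) = f ((a₁ : H₁) ⊗ₜ[K] (a₂ : H₂))) ∧
    (Module.Free (S₁.associatedOrder O) (integralClosure O L₁) →
      Module.Free (S₂.associatedOrder O) (integralClosure O L₂) →
      Module.Free (S.associatedOrder O) (integralClosure O ↥(L₁ ⊔ L₂))) := by
  have h := hstrong.linearDisjoint
  let e := GreitherPareigis.tensorEquivSup h
  let f : H₁ ⊗[K] H₂ ≃ₐ[K] H :=
    AlgEquiv.ofBijective _ (GreitherPareigis.tensorHom_bijective h P₁ P₂ P)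
  have hef := GreitherPareigis.act_tensorHom h P₁ P₂ P
  obtain ⟨b, hb, hb'⟩ := exists_integral_basis O K L₁
  obtain ⟨c, hc, hc'⟩ := exists_integral_basis O K L₂
  have hbc := tensorProduct_repr_mem_range_of_isCoprime harith.isCoprime_discr e b c hb hb' hc hc'
  refine ⟨⟨f, fun h₁ h₂ => ?_, HopfGaloisStructure.orderTensorEquiv S₁ S₂ S e f hef b hb hb' c hc
    hc' hbc, fun a₁ a₂ => ?_⟩, fun _ _ => ?_⟩
  · exact (GreitherPareigis.φ_tensorHom h P₁ P₂ P _).trans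
      (GreitherPareigis.tensorToGroupAlgebra_tmul h P₁ P₂ h₁ h₂)
  · exact HopfGaloisStructure.coe_orderTensorEquiv_tmul S₁ S₂ S e f hef b hb hb' c hc hc' hbc a₁ a₂
  · exact HopfGaloisStructure.free_integralClosure_of_free S₁ S₂ S e f hef b hb hb' c hc hc' hbc
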